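/- Let $n\ge 0$, $T>0$, let $H_0,H_1\in\mathfrak{su}(n)$ (traceless skew-Hermitian $n\times n$ complex matrices) and let $\rho_0,\theta$ be Hermitian $n\times n$ matrices. Let $\mathcal H=L^2([0,T],\mathbb R)$ with $(u,v)_{\mathcal H}=\int_0^T u(t)v(t)\,dt$. For every $u\in\mathcal H$ the equations $$\dot\rho(t)=[H_0+u(t)H_1,\rho(t)],\quad \rho(0)=\rho_0,\qquad\qquad \dot U(t)=(H_0+u(t)H_1)U(t),\quad U(0)=\mathrm{Id},\qquad t\in[0,T],$$ have unique (Carathéodory) solutions; put $\mathrm{End}_{\rho_0}(u):=\rho(T)$, which lies in $\mathcal O(\rho_0):=\{V\rho_0V^\dagger: V\in \mathrm{SU}(n)\}$. Let $J(\rho)=\mathrm{Re}\,\mathrm{tr}(\rho\theta)$ and $\mathcal J(u)=J(\mathrm{End}_{\rho_0}(u))$. Equip $T_\rho\mathcal O(\rho_0)=\{[\rho,\Omega]:\Omega\in\mathfrak{su}(n)\}$ with the scalar product $$\langle[\rho,\Omega_1],[\rho,\Omega_2]\rangle_\rho=\mathrm{tr}\big((\Omega_1^{\mathfrak p_\rho})^\dagger\,\Omega_2^{\mathfrak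 p_\rho}\big),$$ where $\Omega^{\mathfrak p_\rho}$ is the orthogonal projection of $\Omega$, for the scalar product $\mathrm{tr}(\Omega_1^\dagger\Omega_2)$ on $\mathfrak{su}(n)$, onto the orthogonal complement $\mathfrak p_\rho$ of $\{\Lambda\in\mathfrak{su}(n):[\rho,\Lambda]=0\}$. Let $\nabla J(\rho)\in T_\rho\mathcal O(\rho_0)$ be the gradient at $\rho$ of $J$ restricted to $\mathcal O(\rho_0)$, with respect to this metric. Then $\mathrm{End}_{\rho_0}$ is differentiable on $\mathcal H$ and, for every $u\in\mathcal H$, its differential at $u$ maps $\mathcal H$ into the tangent space at $\mathrm{End}_{\rho_0}(u)$. This differential has a unique adjoint $d\mathrm{End}_{\rho_0}^*(u):T_{\mathrm{End}_{\rho_0}(u)}\mathcal O(\rho_0)\to\mathcal H$ with respect to $\langle\cdot,\cdot\rangle_{\mathrm{End}_{\rho_0}(u)}$ and $(\cdot,\cdot)_{\mathcal H}$, the gradient $\nabla J(\mathrm{End}_{\rho_0}(u))$ exists and is unique, and the gradient of $\mathcal J$ at $u$ in $\mathcal H$ is the function given, for almost every $t\in[0,T]$, by $$\nabla\mathcal J(u)(t)=\big(d\mathrm{End}_{\rho_0}^*(u)\,\nabla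 J(\mathrm{End}_{\rho_0}(u))\big)(t)=-\mathrm{tr}\big([\rho_0,U(T)^\dagger\theta U(T)]^\dagger\,U(t)^\dagger H_1U(t)\big),$$ where $U$ is the propagator driven by $u$. (Since the commutator is skew-Hermitian, the right-hand side equals $+\mathrm{tr}([\rho_0,U(T)^\dagger\theta U(T)]\,U(t)^\dagger H_1U(t))$.) -/

import Mathlib

open MeasureTheory Matrix

-- The Hilbert-Schmidt norm on complex matrices.
attribute [local instance] Matrix.frobeniusNormedAddCommGroup
attribute [local instance] Matrix.frobeniusNormedSpace

namespace QuantumControl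

noncomputable section

/-- The real Hilbert space `L²([0,T], ℝ)` of admissible controls, with inner product
`(u, v) = ∫₀ᵀ u(t) v(t) dt`. -/
abbrev Control (T : ℝ) : Type :=
  Lp ℝ 2 (volume.restrict (Set.Icc (0 : ℝ) T))

/-- Traceless skew-Hermitian matrices, as a real vector space. -/
def su (n : ℕ) : Submodule ℝ (Matrix (Fin n) (Fin n) ℂ) :=
  skewAdjoint.submodule ℝ (Matrix (Fin n) (Fin n) ℂ) ⊓
    LinearMap.ker (Matrix.traceLinearMap (Fin n) ℝ ℂ)

/-- `ρ` is a (Carathéodory) solution on `[0,T]` of the controlled Liouville-von Neumann equation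
`ρ'(t) = [H₀ + u(t) H₁, ρ(t)]`, `ρ(0) = ρ₀`: a continuous solution of the integral equation. -/
def IsTrajectory {n : ℕ} {T : ℝ} (H₀ H₁ ρ₀ : Matrix (Fin n) (Fin n) ℂ) (u : Control T)
    (ρ : ℝ → Matrix (Fin n) (Fin n) ℂ) : Prop :=
  ContinuousOn ρ (Set.Icc 0 T) ∧
    ∀ t ∈ Set.Icc 0 T, ρ t = ρ₀ + ∫ s in (0 : ℝ)..t, ⁅H₀ + u s • H₁, ρ s⁆

/-- `U` is a (Carathéodory) solution on `[0,T]` of the propagator equation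
`U'(t) = (H₀ + u(t) H₁) U(t)`, `U(0) = Id`. -/
def IsPropagator {n : ℕ} {T : ℝ} (H₀ H₁ : Matrix (Fin n) (Fin n) ℂ) (u : Control T)
    (U : ℝ → Matrix (Fin n) (Fin n) ℂ) : Prop :=
  ContinuousOn U (Set.Icc 0 T) ∧
    ∀ t ∈ Set.Icc 0 T, U t = 1 + ∫ s in (0 : ℝ)..t, (H₀ + u s • H₁) * U s

open Classical in
/-- The end-point map `u ↦ ρ(T)`, where `ρ` is the solution of the Liouville-von Neumann equation
driven by `u`. -/
def endPoint {n : ℕ} {T : ℝ} (H₀ H₁ ρ₀ : Matrix (Fin n) (Fin n) ℂ) (u : Control T) :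
    Matrix (Fin n) (Fin n) ℂ :=
  if h : ∃ ρ, IsTrajectory H₀ H₁ ρ₀ u ρ then h.choose T else 0

/-- The unitary orbit `{U ρ₀ U† : U ∈ SU(n)}`. -/
def orbit {n : ℕ} (ρ₀ : Matrix (Fin n) (Fin n) ℂ) : Set (Matrix (Fin n) (Fin n) ℂ) :=
  {ρ | ∃ U ∈ Matrix.specialUnitaryGroup (Fin n) ℂ, ρ = U * ρ₀ * Uᴴ}

/-- The tangent space `{[ρ, Ω] : Ω ∈ su(n)}` at `ρ` of the unitary orbit through `ρ`. -/
def tangentSpace {n : ℕ} (ρ : Matrix (Fin n) (Fin n) ℂ) :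
    Submodule ℝ (Matrix (Fin n) (Fin n) ℂ) :=
  (su n).map (LinearMap.mulLeft ℝ ρ - LinearMap.mulRight ℝ ρ)

/-- `Ω` lies in `𝔭_ρ`, the orthogonal complement in `su(n)`, for the scalar product
`tr(Ω₁† Ω₂)`, of the stabilizer algebra `{Λ ∈ su(n) : [ρ, Λ] = 0}` of `ρ`. -/
def MemP {n : ℕ} (ρ Ω : Matrix (Fin n) (Fin n) ℂ) : Prop :=
  Ω ∈ su n ∧ ∀ Λ ∈ su n, ⁅ρ, Λ⁆ = 0 → (Ωᴴ * Λ).trace = 0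

open Classical in
/-- For a tangent vector `ξ` at `ρ`, the unique `Ω ∈ 𝔭_ρ` with `[ρ, Ω] = ξ`; in other words,
`Ω'^{𝔭_ρ}` for any `Ω' ∈ su(n)` with `[ρ, Ω'] = ξ`. -/
def lift {n : ℕ} (ρ ξ : Matrix (Fin n) (Fin n) ℂ) : Matrix (Fin n) (Fin n) ℂ :=
  if h : ∃ Ω, MemP ρ Ω ∧ ⁅ρ, Ω⁆ = ξ then h.choose else 0

/-- The invariant Riemannian metric of the unitary orbit, for tangent vectors at `ρ`:
`⟨[ρ, Ω₁], [ρ, Ω₂]⟩_ρ = tr((Ω₁^{𝔭_ρ})† Ω₂^{𝔭_ρ})` (a real number). -/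
def metric {n : ℕ} (ρ ξ η : Matrix (Fin n) (Fin n) ℂ) : ℝ :=
  ((lift ρ ξ)ᴴ * lift ρ η).trace.re

/-- The cost `J(ρ) = Re tr(ρ θ)`. -/
def cost {n : ℕ} (θ ρ : Matrix (Fin n) (Fin n) ℂ) : ℝ := (ρ * θ).trace.re

/-- `G` is the Riemannian gradient at `ρ` of `J` restricted to the unitary orbit through `ρ`:
`G` is tangent and `dJ(ρ) η = ⟨G, η⟩_ρ` for all tangent `η`. -/
def IsOrbitGradient {n : ℕ} (θ ρ : Matrix (Fin n) (Fin n) ℂ) (G : tangentSpace ρ) : Prop :=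
  ∀ η ∈ tangentSpace ρ, fderiv ℝ (cost θ) ρ η = metric ρ G η

/-- `A` is the adjoint of the differential at `u` of the end-point map, with respect to the
Riemannian metric at the end-point and the inner product of `L²([0,T], ℝ)`. -/
def IsAdjointDiff {n : ℕ} {T : ℝ} (H₀ H₁ ρ₀ : Matrix (Fin n) (Fin n) ℂ) (u : Control T)
    (A : tangentSpace (endPoint H₀ H₁ ρ₀ u) →ₗ[ℝ] Control T) : Prop :=
  ∀ (z : tangentSpace (endPoint H₀ H₁ ρ₀ u)) (v : Control T),
    metric (endPoint H₀ H₁ ρ₀ u) z (fderiv ℝ (endPoint H₀ H₁ ρ₀) u v) = inner ℝ (A z) v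

end

end QuantumControl

open QuantumControl

/-! Both evolution equations have the form x = c + K(u)x on C([0,T], V), where K(u) is a Volterra
operator affine in the control. Cauchy-Schwarz in time gives ‖(Kx)(t)‖² ≤ C ∫₀ᵗ ‖x‖², and iterating
gives ‖Kⁿ‖² ≤ (CT)ⁿ/n!, so 1 - K(u) is invertible for every u in L², however large
(`isUnit_one_sub_systemOperator`). This one fact gives existence and uniqueness. Differentiating the
inverse then shows that the end-point is differentiable in u, its differential being the value at T
of the solution of the linearized equation (`exists_hasFDerivAt_endpoint`).

Variation of constants solves the linearized equation: conjugation by U absorbs the commutator term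
(`IsPropagator.isMildSolution_conj`), so dEnd(u)v = U(T) [∫₀ᵀ v U†H₁U, ρ₀] U(T)†. Since U is only a
primitive of an integrable function, the product rule used here comes from Fubini.

On the orbit, cyclicity of the trace puts [ρ, θ] in 𝔭_ρ, hence ∇J(ρ) = [ρ, [ρ, θ]]. The adjoint A
comes from Riesz representation and is never computed: (A ∇J, v) = ⟨∇J, dEnd(u)v⟩ = J(dEnd(u)v),
which cyclicity turns into ∫ v g with g the stated function. Hence A ∇J = g almost everywhere. -/

namespace QuantumControl

/-! ### Volterra operators with L² coefficients -/

section Volterra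

variable {V : Type*} [NormedAddCommGroup V] [NormedSpace ℝ V] {T : ℝ}

lemma Control.integrableOn (u : Control T) : IntegrableOn u (Set.Icc 0 T) :=
  (Lp.memLp u).integrable one_le_two

lemma Control.integrableOn_smul (u : Control T) {g : ℝ → V} (hg : ContinuousOn g (Set.Icc 0 T)) :
    IntegrableOn (fun s => u s • g s) (Set.Icc 0 T) :=
  IntegrableOn.smul_continuousOn u.integrableOn hg isCompact_Icc

lemma intervalIntegrable_of_integrableOn_Icc {E : Type*} [NormedAddCommGroup E] {f : ℝ → E}
    (hf : IntegrableOn f (Set.Icc 0 T)) {t : ℝ} (ht : t ∈ Set.Icc 0 T) :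
    IntervalIntegrable f volume 0 t := by
  rw [intervalIntegrable_iff_integrableOn_Icc_of_le ht.1]
  exact hf.mono_set (Set.Icc_subset_Icc_right ht.2)

lemma continuousOn_primitive_Icc {f : ℝ → V} (hf : IntegrableOn f (Set.Icc 0 T)) :
    ContinuousOn (fun t => ∫ s in (0 : ℝ)..t, f s) (Set.Icc 0 T) := by
  rcases le_or_gt 0 T with hT | hT
  · rw [← Set.uIcc_of_le hT] at hf ⊢
    exact intervalIntegral.continuousOn_primitive_interval hf
  · simp [Set.Icc_eq_empty_of_lt hT]

lemma Control.integral_sq_le (u : Control T) {t : ℝ} (ht : t ∈ Set.Icc 0 T) :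
    ∫ s in Set.Ioc 0 t, |u s| ^ 2 ≤ ‖u‖ ^ 2 := by
  rw [← real_inner_self_eq_norm_sq, L2.inner_def]
  have h : Integrable (fun s => |u s| ^ 2) (volume.restrict (Set.Icc 0 T)) := by
    simpa using (Lp.memLp u).integrable_sq
  calc ∫ s in Set.Ioc 0 t, |u s| ^ 2 ≤ ∫ s in Set.Icc 0 T, |u s| ^ 2 :=
        setIntegral_mono_set h (Filter.Eventually.of_forall fun _ => by positivity)
          (Set.Ioc_subset_Icc_self.trans (Set.Icc_subset_Icc_right ht.2)).eventuallyLE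
    _ = _ := by simp

/-- Cauchy-Schwarz in time. Keeping the integral of ‖g‖² up to t, rather than a supremum, is what
produces factorials under iteration. -/
lemma Control.norm_integral_smul_sq_le (u : Control T) {g : ℝ → V}
    (hg : ContinuousOn g (Set.Icc 0 T)) {t : ℝ} (ht : t ∈ Set.Icc 0 T) :
    ‖∫ s in (0 : ℝ)..t, u s • g s‖ ^ 2 ≤ ‖u‖ ^ 2 * ∫ s in (0 : ℝ)..t, ‖g s‖ ^ 2 := by
  have hsub : Set.Ioc 0 t ⊆ Set.Icc 0 T :=
    Set.Ioc_subset_Icc_self.trans (Set.Icc_subset_Icc_right ht.2)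
  have hu : MemLp (fun s => |u s|) 2 (volume.restrict (Set.Ioc 0 t)) :=
    ((Lp.memLp u).mono_measure (Measure.restrict_mono_set _ hsub)).norm
  have hgt : ContinuousOn (fun s => ‖g s‖) (Set.Icc 0 t) :=
    (hg.mono (Set.Icc_subset_Icc_right ht.2)).norm
  have hg2 : MemLp (fun s => ‖g s‖) 2 (volume.restrict (Set.Ioc 0 t)) := by
    have h1 : IntegrableOn (fun s => ‖g s‖ ^ 2) (Set.Ioc 0 t) :=
      ((hgt.pow 2).integrableOn_compact isCompact_Icc).mono_set Set.Ioc_subset_Icc_self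
    refine (memLp_two_iff_integrable_sq ?_).2 h1
    exact (hgt.mono Set.Ioc_subset_Icc_self).aestronglyMeasurable measurableSet_Ioc
  have key := integral_mul_le_Lp_mul_Lq_of_nonneg (μ := volume.restrict (Set.Ioc 0 t))
    Real.HolderConjugate.two_two (f := fun s => |u s|) (g := fun s => ‖g s‖)
    (Filter.Eventually.of_forall fun _ => abs_nonneg _)
    (Filter.Eventually.of_forall fun _ => norm_nonneg _) (by simpa using hu) (by simpa using hg2)
  have h0 : ‖∫ s in (0 : ℝ)..t, u s • g s‖ ≤ ∫ s in Set.Ioc 0 t, |u s| * ‖g s‖ := by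
    rw [intervalIntegral.integral_of_le ht.1]
    refine (norm_integral_le_integral_norm _).trans_eq ?_
    simp [norm_smul]
  have h2 := pow_le_pow_left₀ (norm_nonneg _) (h0.trans key) 2
  have e1 : 0 ≤ ∫ s in Set.Ioc 0 t, |u s| ^ 2 := integral_nonneg fun _ => by positivity
  have e2 : 0 ≤ ∫ s in Set.Ioc 0 t, ‖g s‖ ^ 2 := integral_nonneg fun _ => by positivity
  simp only [Real.rpow_ofNat] at h2
  rw [← Real.sqrt_eq_rpow, ← Real.sqrt_eq_rpow, mul_pow, Real.sq_sqrt e1, Real.sq_sqrt e2] at h2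
  rw [intervalIntegral.integral_of_le (f := fun s => ‖g s‖ ^ 2) ht.1]
  exact h2.trans (mul_le_mul_of_nonneg_right (u.integral_sq_le ht) e2)

/-- The primitive `t ↦ ∫₀ᵗ u(s) x(s) ds`, as a continuous function on `[0,T]`. -/
noncomputable def primitive (hT : 0 ≤ T) (u : Control T) (x : C(Set.Icc 0 T, V)) :
    C(Set.Icc 0 T, V) where
  toFun t := ∫ s in (0 : ℝ)..t, u s • Set.IccExtend hT x s
  continuous_toFun := continuousOn_iff_continuous_domRestrict.1 <|
    continuousOn_primitive_Icc <|
      u.integrableOn_smul (x.continuous.Icc_extend' (h := hT)).continuousOn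

lemma primitive_apply (hT : 0 ≤ T) (u : Control T) (x : C(Set.Icc 0 T, V)) (t : Set.Icc 0 T) :
    primitive hT u x t = ∫ s in (0 : ℝ)..t, u s • Set.IccExtend hT x s := rfl

lemma continuous_extend {E : Type*} [NormedAddCommGroup E] (hT : 0 ≤ T) (x : C(Set.Icc 0 T, E)) :
    Continuous (Set.IccExtend hT x) := x.continuous.Icc_extend'

lemma integral_norm_extend_sq_le {E : Type*} [NormedAddCommGroup E] (hT : 0 ≤ T)
    (x : C(Set.Icc 0 T, E)) {t : ℝ} (ht : t ∈ Set.Icc 0 T) :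
    ∫ s in (0 : ℝ)..t, ‖Set.IccExtend hT x s‖ ^ 2 ≤ T * ‖x‖ ^ 2 := by
  have h : ∫ s in (0 : ℝ)..t, ‖Set.IccExtend hT x s‖ ^ 2 ≤ ∫ s in (0 : ℝ)..t, ‖x‖ ^ 2 := by
    refine intervalIntegral.integral_mono_on ht.1 ?_ (by simp) fun s _ => ?_
    · exact ((continuous_extend hT x).norm.pow 2).intervalIntegrable _ _
    · exact pow_le_pow_left₀ (norm_nonneg _) (x.norm_coe_le_norm _) 2
  refine h.trans ?_
  rw [intervalIntegral.integral_const, sub_zero, smul_eq_mul]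
  exact mul_le_mul_of_nonneg_right ht.2 (by positivity)

lemma norm_primitive_le (hT : 0 ≤ T) (u : Control T) (x : C(Set.Icc 0 T, V)) :
    ‖primitive hT u x‖ ≤ √T * ‖u‖ * ‖x‖ := by
  rw [ContinuousMap.norm_le _ (by positivity)]
  intro t
  refine abs_le_of_sq_le_sq' ?_ (by positivity) |>.2
  refine (u.norm_integral_smul_sq_le (continuous_extend hT x).continuousOn t.2).trans ?_
  rw [mul_pow, mul_pow, Real.sq_sqrt hT]
  nlinarith [mul_le_mul_of_nonneg_left (integral_norm_extend_sq_le hT x t.2) (sq_nonneg ‖u‖)]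

/-- The operators `x ↦ ∫₀ᵗ u(s) x(s) ds`, depending linearly and continuously on `u`. -/
noncomputable def volterra (V : Type*) [NormedAddCommGroup V] [NormedSpace ℝ V] (hT : 0 ≤ T) :
    Control T →L[ℝ] C(Set.Icc 0 T, V) →L[ℝ] C(Set.Icc 0 T, V) :=
  LinearMap.mkContinuous₂
    (LinearMap.mk₂ ℝ (primitive hT)
      (fun u v x => by
        ext t
        have hc := (continuous_extend hT x).continuousOn (s := Set.Icc 0 T)
        have hi := fun w : Control T =>
          intervalIntegrable_of_integrableOn_Icc (w.integrableOn_smul hc) t.2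
        simp only [primitive_apply, ContinuousMap.add_apply]
        rw [← intervalIntegral.integral_add (hi u) (hi v)]
        refine intervalIntegral.integral_congr_ae ?_
        have h := (ae_restrict_iff' measurableSet_Icc).1 (Lp.coeFn_add u v)
        filter_upwards [h] with s hs hst
        rw [Set.uIoc_of_le t.2.1] at hst
        rw [hs ⟨hst.1.le, hst.2.trans t.2.2⟩, Pi.add_apply, add_smul])
      (fun c u x => by
        ext t
        simp only [primitive_apply, ContinuousMap.smul_apply]
        rw [← intervalIntegral.integral_smul]
        refine intervalIntegral.integral_congr_ae ?_
        have h := (ae_restrict_iff' measurableSet_Icc).1 (Lp.coeFn_smul c u)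
        filter_upwards [h] with s hs hst
        rw [Set.uIoc_of_le t.2.1] at hst
        rw [hs ⟨hst.1.le, hst.2.trans t.2.2⟩, Pi.smul_apply, smul_assoc])
      (fun u x y => by
        ext t
        have hi := fun z : C(Set.Icc 0 T, V) => intervalIntegrable_of_integrableOn_Icc
          (u.integrableOn_smul (continuous_extend hT z).continuousOn) t.2
        simp only [primitive_apply, ContinuousMap.add_apply]
        rw [← intervalIntegral.integral_add (hi x) (hi y)]
        simp [Set.IccExtend])
      (fun c u x => by
        ext t
        simp only [primitive_apply, ContinuousMap.smul_apply]
        rw [← intervalIntegral.integral_smul]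
        simp [Set.IccExtend, smul_comm c]))
    √T (norm_primitive_le hT)

/-- Each application of K integrates sⁿ once more and so gains a factor t/(n+1). -/
lemma norm_pow_apply_sq_le (hT : 0 ≤ T) {C : ℝ} (hC : 0 ≤ C)
    (K : C(Set.Icc 0 T, V) →L[ℝ] C(Set.Icc 0 T, V))
    (hK : ∀ x t, ‖K x t‖ ^ 2 ≤ C * ∫ s in (0 : ℝ)..t, ‖Set.IccExtend hT x s‖ ^ 2)
    (n : ℕ) (x : C(Set.Icc 0 T, V)) (t : Set.Icc 0 T) :
    ‖(K ^ n) x t‖ ^ 2 ≤ (C * t) ^ n / n.factorial * ‖x‖ ^ 2 := by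
  induction n generalizing t with
  | zero =>
    simpa using pow_le_pow_left₀ (norm_nonneg _) (x.norm_coe_le_norm t) 2
  | succ n ih =>
    rw [show (K ^ (n + 1)) x = K ((K ^ n) x) by rw [pow_succ' K]; rfl]
    refine (hK _ t).trans ?_
    have h : ∫ s in (0 : ℝ)..t, ‖Set.IccExtend hT ((K ^ n) x) s‖ ^ 2 ≤
        ∫ s in (0 : ℝ)..t, s ^ n * (C ^ n / n.factorial * ‖x‖ ^ 2) := by
      refine intervalIntegral.integral_mono_on t.2.1 ?_ ?_ fun s hs => ?_
      · exact ((continuous_extend hT _).norm.pow 2).intervalIntegrable _ _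
      · exact (by fun_prop : Continuous _).intervalIntegrable _ _
      · have hs' : s ∈ Set.Icc 0 T := ⟨hs.1, hs.2.trans t.2.2⟩
        rw [Set.IccExtend_of_mem _ _ hs']
        refine (ih ⟨s, hs'⟩).trans_eq ?_
        rw [mul_pow]
        ring
    refine (mul_le_mul_of_nonneg_left h hC).trans_eq ?_
    rw [intervalIntegral.integral_mul_const, integral_pow, Nat.factorial_succ]
    push_cast
    field_simp
    ring

/-- K need not be a contraction, but some power Kⁿ is. Then 1 - Kⁿ = (1 - K)(1 + K + ⋯ + Kⁿ⁻¹) is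
invertible, and its factors commute, so each of them is. -/
lemma isUnit_one_sub_of_volterra_bound [CompleteSpace V] (hT : 0 ≤ T) {C : ℝ} (hC : 0 ≤ C)
    (K : C(Set.Icc 0 T, V) →L[ℝ] C(Set.Icc 0 T, V))
    (hK : ∀ x t, ‖K x t‖ ^ 2 ≤ C * ∫ s in (0 : ℝ)..t, ‖Set.IccExtend hT x s‖ ^ 2) :
    IsUnit (1 - K) := by
  obtain ⟨n, hn⟩ := ((FloorSemiring.tendsto_pow_div_factorial_atTop (C * T)).eventually_lt_const
    one_pos).exists
  have hpos : 0 ≤ (C * T) ^ n / n.factorial := by positivity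
  have hnorm : ‖K ^ n‖ ≤ √((C * T) ^ n / n.factorial) := by
    refine ContinuousLinearMap.opNorm_le_bound _ (by positivity) fun x => ?_
    rw [ContinuousMap.norm_le _ (by positivity)]
    intro t
    refine abs_le_of_sq_le_sq' ?_ (by positivity) |>.2
    refine (norm_pow_apply_sq_le hT hC K hK n x t).trans ?_
    rw [mul_pow (√_), Real.sq_sqrt hpos]
    have ht0 := t.2.1
    have ht1 := t.2.2
    gcongr
  have hu : IsUnit (1 - K ^ n) := by
    refine isUnit_one_sub_of_norm_lt_one (x := K ^ n) (hnorm.trans_lt ?_)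
    rw [Real.sqrt_lt' one_pos]
    simpa using hn
  rw [← mul_neg_geom_sum] at hu
  refine ((Commute.isUnit_mul_iff ?_).1 hu).1
  exact ((Commute.one_left _).sub_left (Commute.sum_right _ _ _ fun i _ => Commute.self_pow K i))

end Volterra

/-! ### Linear control systems: well-posedness and differentiability of the end-point -/

section LinearControlSystem

variable {V : Type*} [NormedAddCommGroup V] [NormedSpace ℝ V] {T : ℝ}

/-- The constant control `1`. -/
noncomputable def oneControl (T : ℝ) : Control T :=
  (memLp_const (1 : ℝ)).toLp (fun _ => (1 : ℝ))

/-- Lets the drift L₀ be treated as one more controlled term, so that the same Volterra estimate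
covers both. -/
lemma integral_oneControl_smul (g : ℝ → V) {t : ℝ} (ht : t ∈ Set.Icc 0 T) :
    ∫ s in (0 : ℝ)..t, oneControl T s • g s = ∫ s in (0 : ℝ)..t, g s := by
  refine intervalIntegral.integral_congr_ae ?_
  have h := (ae_restrict_iff' measurableSet_Icc).1
    (MemLp.coeFn_toLp (memLp_const (1 : ℝ) : MemLp (fun _ => (1 : ℝ)) 2
      (volume.restrict (Set.Icc 0 T))))
  filter_upwards [h] with s hs hst
  rw [Set.uIoc_of_le ht.1] at hst
  rw [oneControl, hs ⟨hst.1.le, hst.2.trans ht.2⟩, one_smul]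

/-- `f` solves the integral equation `f(t) = g(t) + ∫₀ᵗ (L₀ + u(s) L₁) f(s) ds` on `[0,T]`. -/
def IsMildSolution (L₀ L₁ : V →L[ℝ] V) (u : Control T) (g f : ℝ → V) : Prop :=
  ContinuousOn f (Set.Icc 0 T) ∧
    ∀ t ∈ Set.Icc 0 T, f t = g t + ∫ s in (0 : ℝ)..t, (L₀ (f s) + u s • L₁ (f s))

/-- The operator `x ↦ ∫₀ᵗ (L₀ + u(s) L₁) x(s) ds` on `C([0,T], V)`. -/
noncomputable def systemOperator (hT : 0 ≤ T) (L₀ L₁ : V →L[ℝ] V) (u : Control T) :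
    C(Set.Icc 0 T, V) →L[ℝ] C(Set.Icc 0 T, V) :=
  (volterra V hT (oneControl T)).comp (L₀.compLeftContinuous ℝ (Set.Icc 0 T)) +
    (volterra V hT u).comp (L₁.compLeftContinuous ℝ (Set.Icc 0 T))

lemma systemOperator_apply (hT : 0 ≤ T) (L₀ L₁ : V →L[ℝ] V) (u : Control T)
    (x : C(Set.Icc 0 T, V)) (t : Set.Icc 0 T) :
    systemOperator hT L₀ L₁ u x t = ∫ s in (0 : ℝ)..t,
      (L₀ (Set.IccExtend hT x s) + u s • L₁ (Set.IccExtend hT x s)) := by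
  have hx := continuous_extend hT x
  have h₀ : Continuous fun s => L₀ (Set.IccExtend hT x s) := L₀.continuous.comp hx
  have h₁ : Continuous fun s => L₁ (Set.IccExtend hT x s) := L₁.continuous.comp hx
  rw [intervalIntegral.integral_add (h₀.intervalIntegrable _ _)
    (intervalIntegrable_of_integrableOn_Icc (u.integrableOn_smul h₁.continuousOn) t.2),
    ← integral_oneControl_smul _ t.2]
  rfl

lemma norm_volterra_comp_sq_le (hT : 0 ≤ T) (L : V →L[ℝ] V) (u : Control T)
    (x : C(Set.Icc 0 T, V)) (t : Set.Icc 0 T) :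
    ‖volterra V hT u (L.compLeftContinuous ℝ (Set.Icc 0 T) x) t‖ ^ 2 ≤
      (‖u‖ ^ 2 * ‖L‖ ^ 2) * ∫ s in (0 : ℝ)..t, ‖Set.IccExtend hT x s‖ ^ 2 := by
  have hx := continuous_extend hT x
  have hLx := L.continuous.comp hx
  refine (u.norm_integral_smul_sq_le hLx.continuousOn t.2).trans ?_
  rw [mul_assoc, ← intervalIntegral.integral_const_mul (‖L‖ ^ 2)]
  refine mul_le_mul_of_nonneg_left ?_ (sq_nonneg ‖u‖)
  refine intervalIntegral.integral_mono_on t.2.1 ((hLx.norm.pow 2).intervalIntegrable _ _)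
    ((continuous_const.mul (hx.norm.pow 2)).intervalIntegrable _ _) fun s _ => ?_
  rw [← mul_pow]
  exact pow_le_pow_left₀ (norm_nonneg _) (L.le_opNorm _) 2

lemma isUnit_one_sub_systemOperator [CompleteSpace V] (hT : 0 ≤ T) (L₀ L₁ : V →L[ℝ] V)
    (u : Control T) : IsUnit (1 - systemOperator hT L₀ L₁ u) := by
  refine isUnit_one_sub_of_volterra_bound hT
    -- The factor 2 comes from (a + b)² ≤ 2(a² + b²), applied to drift and control terms.
    (C := 2 * (‖oneControl T‖ ^ 2 * ‖L₀‖ ^ 2 + ‖u‖ ^ 2 * ‖L₁‖ ^ 2)) (by positivity) _ fun x t => ?_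
  have h0 := norm_volterra_comp_sq_le hT L₀ (oneControl T) x t
  have h1 := norm_volterra_comp_sq_le hT L₁ u x t
  have h2 : ‖systemOperator hT L₀ L₁ u x t‖ ≤ _ := norm_add_le
    (volterra V hT (oneControl T) (L₀.compLeftContinuous ℝ (Set.Icc 0 T) x) t)
    (volterra V hT u (L₁.compLeftContinuous ℝ (Set.Icc 0 T) x) t)
  refine (pow_le_pow_left₀ (norm_nonneg _) h2 2).trans (add_sq_le.trans ?_)
  linarith

/-- Bridge between functions on ℝ, whose values off [0,T] are irrelevant, and the Banach space
C([0,T], V) where the operator is inverted. -/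
lemma isMildSolution_extend_iff (hT : 0 ≤ T) (L₀ L₁ : V →L[ℝ] V) (u : Control T) {g : ℝ → V}
    (y : C(Set.Icc 0 T, V)) (hy : ∀ t : Set.Icc 0 T, y t = g t) (x : C(Set.Icc 0 T, V)) :
    IsMildSolution L₀ L₁ u g (Set.IccExtend hT x) ↔ (1 - systemOperator hT L₀ L₁ u) x = y := by
  rw [IsMildSolution, and_iff_right (continuous_extend hT x).continuousOn,
    _root_.sub_apply, ContinuousMap.ext_iff, Subtype.forall]
  refine forall₂_congr fun t ht => ?_
  rw [ContinuousMap.sub_apply, systemOperator_apply, hy, sub_eq_iff_eq_add,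
    Set.IccExtend_of_mem _ _ ht]
  rfl

lemma IsMildSolution.congr {L₀ L₁ : V →L[ℝ] V} {u : Control T} {g f f' : ℝ → V}
    (hf : IsMildSolution L₀ L₁ u g f) (h : Set.EqOn f' f (Set.Icc 0 T)) :
    IsMildSolution L₀ L₁ u g f' := by
  refine ⟨hf.1.congr h, fun t ht => ?_⟩
  rw [h ht, hf.2 t ht]
  congr 1
  refine intervalIntegral.integral_congr fun s hs => ?_
  rw [Set.uIcc_of_le ht.1] at hs
  simp only [h ⟨hs.1, hs.2.trans ht.2⟩]

/-- The restriction to `[0,T]` of a function that is continuous there. -/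
def restrictIcc (f : ℝ → V) (hf : ContinuousOn f (Set.Icc 0 T)) : C(Set.Icc 0 T, V) :=
  ⟨(Set.Icc 0 T).domRestrict f, continuousOn_iff_continuous_domRestrict.1 hf⟩

lemma IsMildSolution.one_sub_apply (hT : 0 ≤ T) {L₀ L₁ : V →L[ℝ] V} {u : Control T} {g f : ℝ → V}
    (hf : IsMildSolution L₀ L₁ u g f) (y : C(Set.Icc 0 T, V)) (hy : ∀ t : Set.Icc 0 T, y t = g t) :
    (1 - systemOperator hT L₀ L₁ u) (restrictIcc f hf.1) = y :=
  (isMildSolution_extend_iff hT L₀ L₁ u y hy _).1 <|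
    hf.congr fun _ ht => Set.IccExtend_of_mem hT _ ht

lemma inverse_apply_apply {E : Type*} [NormedAddCommGroup E] [NormedSpace ℝ E] {A : E →L[ℝ] E}
    (hA : IsUnit A) (x : E) : Ring.inverse A (A x) = x :=
  congr($(Ring.inverse_mul_cancel A hA) x)

lemma apply_inverse_apply {E : Type*} [NormedAddCommGroup E] [NormedSpace ℝ E] {A : E →L[ℝ] E}
    (hA : IsUnit A) (x : E) : A (Ring.inverse A x) = x :=
  congr($(Ring.mul_inverse_cancel A hA) x)

theorem _root_.HasFDerivAt.exists_ringInverse {F R : Type*} [NormedAddCommGroup F]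
    [NormedSpace ℝ F] [NormedRing R] [NormedAlgebra ℝ R] [HasSummableGeomSeries R] {A : F → R}
    {A' : F →L[ℝ] R} {u : F} (hA : HasFDerivAt A A' u) (hu : IsUnit (A u)) :
    ∃ D : F →L[ℝ] R, HasFDerivAt (fun w => Ring.inverse (A w)) D u ∧
      ∀ v, D v = -(Ring.inverse (A u) * A' v * Ring.inverse (A u)) := by
  obtain ⟨U, hU⟩ := hu
  have hinv := hasFDerivAt_ringInverse (𝕜 := ℝ) U
  rw [hU] at hinv
  have hcomp := HasFDerivAt.comp u hinv hA
  refine ⟨_, hcomp, fun v => ?_⟩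
  rw [← hU, Ring.inverse_unit]
  simp

variable [CompleteSpace V]

theorem exists_isMildSolution (hT : 0 ≤ T) (L₀ L₁ : V →L[ℝ] V) (u : Control T) {g : ℝ → V}
    (hg : ContinuousOn g (Set.Icc 0 T)) : ∃ f, IsMildSolution L₀ L₁ u g f :=
  ⟨_, (isMildSolution_extend_iff hT L₀ L₁ u (restrictIcc g hg) (fun _ => rfl)
    (Ring.inverse (1 - systemOperator hT L₀ L₁ u) (restrictIcc g hg))).2
      (apply_inverse_apply (isUnit_one_sub_systemOperator hT L₀ L₁ u) _)⟩

theorem IsMildSolution.eqOn (hT : 0 ≤ T) {L₀ L₁ : V →L[ℝ] V} {u : Control T} {g f f' : ℝ → V}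
    (hg : ContinuousOn g (Set.Icc 0 T)) (hf : IsMildSolution L₀ L₁ u g f)
    (hf' : IsMildSolution L₀ L₁ u g f') : Set.EqOn f f' (Set.Icc 0 T) := by
  have h := hf.one_sub_apply hT (restrictIcc g hg) (fun _ => rfl)
  have h' := hf'.one_sub_apply hT (restrictIcc g hg) (fun _ => rfl)
  have hu := isUnit_one_sub_systemOperator hT L₀ L₁ u
  have : restrictIcc f hf.1 = restrictIcc f' hf'.1 := by
    rw [← inverse_apply_apply hu (restrictIcc f hf.1), h, ← h', inverse_apply_apply hu]
  exact fun t ht => congr($this ⟨t, ht⟩)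

/-- The end-point of the solution of a linear control system is a differentiable function of the
control, and its differential is the end-point of the solution of the linearized system. -/
theorem exists_hasFDerivAt_endpoint (hT : 0 ≤ T) (L₀ L₁ : V →L[ℝ] V) (x₀ : V) (E : Control T → V)
    (hE : ∀ u, ∃ f, IsMildSolution L₀ L₁ u (fun _ => x₀) f ∧ E u = f T) (u : Control T) :
    ∃ D : Control T →L[ℝ] V, HasFDerivAt E D u ∧
      ∀ f, IsMildSolution L₀ L₁ u (fun _ => x₀) f → ∀ v z,
        IsMildSolution L₀ L₁ u (fun t => ∫ s in (0 : ℝ)..t, v s • L₁ (f s)) z → D v = z T := by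
  have hTm : T ∈ Set.Icc 0 T := ⟨hT, le_rfl⟩
  let ev : C(Set.Icc 0 T, V) →L[ℝ] V := ContinuousMap.evalCLM ℝ ⟨T, hTm⟩
  let c : C(Set.Icc 0 T, V) := ContinuousMap.const _ x₀
  let M := L₁.compLeftContinuous ℝ (Set.Icc 0 T)
  let K₁ : Control T →L[ℝ] (C(Set.Icc 0 T, V) →L[ℝ] C(Set.Icc 0 T, V)) :=
    ((ContinuousLinearMap.compL ℝ C(Set.Icc 0 T, V) C(Set.Icc 0 T, V) C(Set.Icc 0 T, V)).flip M).comp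
      (volterra V hT)
  have hE' : E = fun w => ev (Ring.inverse (1 - systemOperator hT L₀ L₁ w) c) := by
    ext w
    obtain ⟨f, hf, hEf⟩ := hE w
    rw [hEf, ← hf.one_sub_apply hT c (fun _ => rfl),
      inverse_apply_apply (isUnit_one_sub_systemOperator hT L₀ L₁ w)]
    rfl
  -- The operator is affine in w: a constant drift part plus the continuous linear K₁.
  have hK : HasFDerivAt (fun w => 1 - systemOperator hT L₀ L₁ w) (-K₁) u :=
    (K₁.hasFDerivAt.const_add ((volterra V hT (oneControl T)).comp
      (L₀.compLeftContinuous ℝ (Set.Icc 0 T)))).const_sub 1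
  have hunit := isUnit_one_sub_systemOperator hT L₀ L₁ u
  obtain ⟨D, hD, hDv⟩ : ∃ D : Control T →L[ℝ] C(Set.Icc 0 T, V) →L[ℝ] C(Set.Icc 0 T, V),
      HasFDerivAt (fun w => Ring.inverse (1 - systemOperator hT L₀ L₁ w)) D u ∧
      ∀ v, D v = -(Ring.inverse (1 - systemOperator hT L₀ L₁ u) * (-K₁) v *
        Ring.inverse (1 - systemOperator hT L₀ L₁ u)) :=
    HasFDerivAt.exists_ringInverse (R := C(Set.Icc 0 T, V) →L[ℝ] C(Set.Icc 0 T, V)) hK hunit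
  let ψ : (C(Set.Icc 0 T, V) →L[ℝ] C(Set.Icc 0 T, V)) →L[ℝ] V :=
    ev.comp (ContinuousLinearMap.apply ℝ C(Set.Icc 0 T, V) c)
  have hED : HasFDerivAt (fun w => ψ (Ring.inverse (1 - systemOperator hT L₀ L₁ w)))
      (ψ.comp D) u := by
    exact HasFDerivAt.comp (𝕜 := ℝ) (F := C(Set.Icc 0 T, V) →L[ℝ] C(Set.Icc 0 T, V)) (g := ψ)
      (f := fun w => Ring.inverse (1 - systemOperator hT L₀ L₁ w)) (f' := D) (g' := ψ) u
      ψ.hasFDerivAt hD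
  refine ⟨_, hE' ▸ hED, fun f hf v z hz => ?_⟩
  have hx : Ring.inverse (1 - systemOperator hT L₀ L₁ u) c = restrictIcc f hf.1 := by
    rw [← hf.one_sub_apply hT c (fun _ => rfl), inverse_apply_apply hunit]
  -- K₁ v f is exactly the forcing term of the linearized equation, so z = (1 - K(u))⁻¹ K₁ v f.
  have hzy := hz.one_sub_apply hT (K₁ v (restrictIcc f hf.1)) fun t => by
    refine intervalIntegral.integral_congr fun s hs => ?_
    rw [Set.uIcc_of_le t.2.1] at hs
    have hs' : s ∈ Set.Icc 0 T := ⟨hs.1, hs.2.trans t.2.2⟩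
    change v s • L₁ (Set.IccExtend hT (restrictIcc f hf.1) s) = _
    rw [Set.IccExtend_of_mem _ _ hs']
    rfl
  have : Ring.inverse (1 - systemOperator hT L₀ L₁ u) (K₁ v (restrictIcc f hf.1)) =
      restrictIcc z hz.1 := by
    rw [← hzy, inverse_apply_apply hunit]
  calc _ = ev (Ring.inverse (1 - systemOperator hT L₀ L₁ u) (K₁ v
        (Ring.inverse (1 - systemOperator hT L₀ L₁ u) c))) := by
        change ev (D v c) = _
        rw [hDv v]
        simp
    _ = z T := by rw [hx, this]; rfl

end LinearControlSystem

/-! ### Product rule for primitives of integrable functions -/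

section ProductRule

variable {A : Type*} [NormedRing A] [NormedAlgebra ℝ A]

/-- Fubini on the square (0,t]², cut along the diagonal. The order of the factors is kept because A
is noncommutative. -/
lemma integral_mul_integral_eq {f g : ℝ → A} {t : ℝ} (hf : IntegrableOn f (Set.Ioc 0 t))
    (hg : IntegrableOn g (Set.Ioc 0 t)) :
    (∫ s in Set.Ioc 0 t, f s) * (∫ s in Set.Ioc 0 t, g s) =
      (∫ s in Set.Ioc 0 t, f s * ∫ r in Set.Ioc 0 s, g r) +
        ∫ r in Set.Ioc 0 t, (∫ s in Set.Ioc 0 r, f s) * g r := by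
  let ν := volume.restrict (Set.Ioc (0 : ℝ) t)
  let h : ℝ × ℝ → A := fun p => f p.1 * g p.2
  have hh : Integrable h (ν.prod ν) :=
    Integrable.op_fst_snd (op := fun x y : A => x * y) continuous_mul
      ⟨1, fun x y => by simpa using norm_mul_le x y⟩ hf hg
  let S : Set (ℝ × ℝ) := {p | p.2 ≤ p.1}
  have hS : MeasurableSet S := measurableSet_le measurable_snd measurable_fst
  have htot : ∫ p, h p ∂ν.prod ν =
      (∫ s in Set.Ioc 0 t, f s) * ∫ r in Set.Ioc 0 t, g r := by
    rw [integral_prod _ hh, ← integral_mul_const_of_integrable hf]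
    exact integral_congr_ae <| Filter.Eventually.of_forall fun s =>
      integral_const_mul_of_integrable (c := f s) hg
  have hlow : ∫ p in S, h p ∂ν.prod ν =
      ∫ s in Set.Ioc 0 t, f s * ∫ r in Set.Ioc 0 s, g r := by
    rw [← integral_indicator hS, integral_prod _ (hh.indicator hS)]
    refine setIntegral_congr_fun measurableSet_Ioc fun s hs => ?_
    have e : (fun r => S.indicator h (s, r)) = (Set.Iic s).indicator (fun r => f s * g r) := by
      ext r
      simp [S, h, Set.indicator_apply]
    have e2 : Set.Iic s ∩ Set.Ioc 0 t = Set.Ioc 0 s := by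
      ext r
      simp only [Set.mem_inter_iff, Set.mem_Iic, Set.mem_Ioc]
      exact ⟨fun h => ⟨h.2.1, h.1⟩, fun h => ⟨h.2, h.1, h.2.trans hs.2⟩⟩
    simp only [e, ν]
    rw [integral_indicator measurableSet_Iic, Measure.restrict_restrict measurableSet_Iic, e2]
    exact integral_const_mul_of_integrable (hg.mono_set (Set.Ioc_subset_Ioc_right hs.2))
  have hup : ∫ p in Sᶜ, h p ∂ν.prod ν =
      ∫ r in Set.Ioc 0 t, (∫ s in Set.Ioc 0 r, f s) * g r := by
    rw [← integral_indicator hS.compl, integral_prod_symm _ (hh.indicator hS.compl)]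
    refine setIntegral_congr_fun measurableSet_Ioc fun r hr => ?_
    have e : (fun s => Sᶜ.indicator h (s, r)) = (Set.Iio r).indicator (fun s => f s * g r) := by
      ext s
      simp [S, h, Set.indicator_apply]
    have e2 : Set.Iio r ∩ Set.Ioc 0 t = Set.Ioo 0 r := by
      ext s
      simp only [Set.mem_inter_iff, Set.mem_Iio, Set.mem_Ioc, Set.mem_Ioo]
      exact ⟨fun h => ⟨h.2.1, h.1⟩, fun h => ⟨h.2, h.1, h.2.le.trans hr.2⟩⟩
    simp only [e, ν]
    rw [integral_indicator measurableSet_Iio, Measure.restrict_restrict measurableSet_Iio, e2,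
      ← integral_Ioc_eq_integral_Ioo]
    exact integral_mul_const_of_integrable (hf.mono_set (Set.Ioc_subset_Ioc_right hr.2))
  rw [← hlow, ← hup, integral_add_compl hS hh, htot]

/-- The product rule for primitives of integrable functions. -/
theorem primitive_mul_primitive [CompleteSpace A] {T : ℝ} {F G f g : ℝ → A} {a b : A}
    (hf : IntegrableOn f (Set.Icc 0 T)) (hg : IntegrableOn g (Set.Icc 0 T))
    (hF : ∀ t ∈ Set.Icc 0 T, F t = a + ∫ s in (0 : ℝ)..t, f s)
    (hG : ∀ t ∈ Set.Icc 0 T, G t = b + ∫ s in (0 : ℝ)..t, g s) :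
    IntegrableOn (fun s => f s * G s + F s * g s) (Set.Icc 0 T) ∧
    ∀ t ∈ Set.Icc 0 T, F t * G t = a * b + ∫ s in (0 : ℝ)..t, (f s * G s + F s * g s) := by
  have hFc : ContinuousOn F (Set.Icc 0 T) :=
    (continuousOn_const.add (continuousOn_primitive_Icc hf)).congr hF
  have hGc : ContinuousOn G (Set.Icc 0 T) :=
    (continuousOn_const.add (continuousOn_primitive_Icc hg)).congr hG
  have h1 : IntegrableOn (fun s => f s * G s) (Set.Icc 0 T) :=
    hf.mul_continuousOn hGc isCompact_Icc
  have h2 : IntegrableOn (fun s => F s * g s) (Set.Icc 0 T) :=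
    hg.continuousOn_mul hFc isCompact_Icc
  refine ⟨h1.add h2, fun t ht => ?_⟩
  have hsub : Set.Ioc 0 t ⊆ Set.Icc 0 T :=
    Set.Ioc_subset_Icc_self.trans (Set.Icc_subset_Icc_right ht.2)
  have hft := hf.mono_set hsub
  have hgt := hg.mono_set hsub
  have hcf := (continuousOn_primitive_Icc hf)
  have hcg := (continuousOn_primitive_Icc hg)
  have hfg : IntegrableOn (fun s => f s * ∫ r in (0 : ℝ)..s, g r) (Set.Icc 0 T) :=
    hf.mul_continuousOn hcg isCompact_Icc
  have hfg' : IntegrableOn (fun s => (∫ r in (0 : ℝ)..s, f r) * g s) (Set.Icc 0 T) :=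
    hg.continuousOn_mul hcf isCompact_Icc
  have key := integral_mul_integral_eq hft hgt
  have e1 : ∫ s in Set.Ioc 0 t, f s * G s =
      (∫ s in Set.Ioc 0 t, f s) * b + ∫ s in Set.Ioc 0 t, f s * ∫ r in Set.Ioc 0 s, g r := by
    rw [← integral_mul_const_of_integrable hft, ← integral_add]
    · refine setIntegral_congr_fun measurableSet_Ioc fun s hs => ?_
      simp only [hG s (hsub hs), mul_add, intervalIntegral.integral_of_le hs.1.le]
    · exact hft.mul_const b
    · refine (hfg.mono_set hsub).congr_fun (fun s hs => ?_) measurableSet_Ioc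
      simp only [intervalIntegral.integral_of_le hs.1.le]
  have e2 : ∫ s in Set.Ioc 0 t, F s * g s =
      a * (∫ s in Set.Ioc 0 t, g s) + ∫ s in Set.Ioc 0 t, (∫ r in Set.Ioc 0 s, f r) * g s := by
    rw [← integral_const_mul_of_integrable hgt, ← integral_add]
    · refine setIntegral_congr_fun measurableSet_Ioc fun s hs => ?_
      simp only [hF s (hsub hs), add_mul, intervalIntegral.integral_of_le hs.1.le]
    · exact hgt.const_mul a
    · refine (hfg'.mono_set hsub).congr_fun (fun s hs => ?_) measurableSet_Ioc
      simp only [intervalIntegral.integral_of_le hs.1.le]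
  rw [hF t ht, hG t ht]
  simp only [intervalIntegral.integral_of_le ht.1]
  rw [integral_add (h1.mono_set hsub) (h2.mono_set hsub), e1, e2, add_mul, mul_add, mul_add, key]
  abel

end ProductRule

/-- The topology of the Hilbert-Schmidt norm; definitionally equal to the product topology, but
found by unification with the one that the normed-space instances provide. -/
@[reducible] noncomputable def frobeniusTopology (n : ℕ) : TopologicalSpace (Matrix (Fin n) (Fin n) ℂ) :=
  (Matrix.frobeniusNormedAddCommGroup (m := Fin n) (n := Fin n) (α := ℂ)).toMetricSpace
    |>.toPseudoMetricSpace.toUniformSpace.toTopologicalSpace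

/-! ### Trajectories, propagators and the differential of the end-point map -/

section Evolution

attribute [local instance] frobeniusTopology

variable {n : ℕ} {T : ℝ}

lemma mem_su_iff {A : Matrix (Fin n) (Fin n) ℂ} : A ∈ su n ↔ Aᴴ = -A ∧ A.trace = 0 := Iff.rfl

/-- Left multiplication by a matrix, as a continuous linear map. -/
noncomputable def leftMulCLM (H : Matrix (Fin n) (Fin n) ℂ) :
    Matrix (Fin n) (Fin n) ℂ →L[ℝ] Matrix (Fin n) (Fin n) ℂ :=
  LinearMap.toContinuousLinearMap (LinearMap.mulLeft ℝ H)

/-- The commutator with a matrix, as a continuous linear map. -/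
noncomputable def adCLM (H : Matrix (Fin n) (Fin n) ℂ) :
    Matrix (Fin n) (Fin n) ℂ →L[ℝ] Matrix (Fin n) (Fin n) ℂ :=
  LinearMap.toContinuousLinearMap (LinearMap.mulLeft ℝ H - LinearMap.mulRight ℝ H)

/-- The conjugate transpose, as a continuous linear map. -/
noncomputable def conjTransposeCLM (n : ℕ) :
    Matrix (Fin n) (Fin n) ℂ →L[ℝ] Matrix (Fin n) (Fin n) ℂ :=
  LinearMap.toContinuousLinearMap (Matrix.conjTransposeLinearEquiv (Fin n) (Fin n) ℝ ℂ).toLinearMap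

@[simp] lemma leftMulCLM_apply (H X : Matrix (Fin n) (Fin n) ℂ) : leftMulCLM H X = H * X := rfl

@[simp] lemma adCLM_apply (H X : Matrix (Fin n) (Fin n) ℂ) : adCLM H X = ⁅H, X⁆ := rfl

@[simp] lemma conjTransposeCLM_apply (X : Matrix (Fin n) (Fin n) ℂ) :
    conjTransposeCLM n X = Xᴴ := rfl

variable {H₀ H₁ ρ₀ : Matrix (Fin n) (Fin n) ℂ} {u : Control T}

lemma isTrajectory_iff {ρ : ℝ → Matrix (Fin n) (Fin n) ℂ} :
    IsTrajectory H₀ H₁ ρ₀ u ρ ↔ IsMildSolution (adCLM H₀) (adCLM H₁) u (fun _ => ρ₀) ρ := by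
  simp only [IsTrajectory, IsMildSolution, adCLM_apply, Ring.lie_def, add_mul, mul_add,
    smul_mul_assoc, mul_smul_comm, smul_sub, add_sub_add_comm]
  exact Iff.rfl

lemma isPropagator_iff {U : ℝ → Matrix (Fin n) (Fin n) ℂ} :
    IsPropagator H₀ H₁ u U ↔
      IsMildSolution (leftMulCLM H₀) (leftMulCLM H₁) u (fun _ => 1) U := by
  simp only [IsPropagator, IsMildSolution, leftMulCLM_apply, add_mul, smul_mul_assoc]
  exact Iff.rfl

theorem exists_isTrajectory (hT : 0 ≤ T) (H₀ H₁ ρ₀ : Matrix (Fin n) (Fin n) ℂ) (u : Control T) :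
    ∃ ρ, IsTrajectory H₀ H₁ ρ₀ u ρ := by
  simp only [isTrajectory_iff]
  exact exists_isMildSolution hT _ _ u continuousOn_const

theorem IsTrajectory.eqOn (hT : 0 ≤ T) {ρ ρ' : ℝ → Matrix (Fin n) (Fin n) ℂ}
    (h : IsTrajectory H₀ H₁ ρ₀ u ρ) (h' : IsTrajectory H₀ H₁ ρ₀ u ρ') :
    Set.EqOn ρ ρ' (Set.Icc 0 T) :=
  (isTrajectory_iff.1 h).eqOn hT continuousOn_const (isTrajectory_iff.1 h')

theorem exists_isPropagator (hT : 0 ≤ T) (H₀ H₁ : Matrix (Fin n) (Fin n) ℂ) (u : Control T) :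
    ∃ U, IsPropagator H₀ H₁ u U := by
  simp only [isPropagator_iff]
  exact exists_isMildSolution hT _ _ u continuousOn_const

theorem IsPropagator.eqOn (hT : 0 ≤ T) {U U' : ℝ → Matrix (Fin n) (Fin n) ℂ}
    (h : IsPropagator H₀ H₁ u U) (h' : IsPropagator H₀ H₁ u U') :
    Set.EqOn U U' (Set.Icc 0 T) :=
  (isPropagator_iff.1 h).eqOn hT continuousOn_const (isPropagator_iff.1 h')

theorem endPoint_eq (hT : 0 ≤ T) {ρ : ℝ → Matrix (Fin n) (Fin n) ℂ}
    (h : IsTrajectory H₀ H₁ ρ₀ u ρ) : endPoint H₀ H₁ ρ₀ u = ρ T := by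
  have hex : ∃ ρ, IsTrajectory H₀ H₁ ρ₀ u ρ := ⟨ρ, h⟩
  rw [endPoint, dif_pos hex]
  exact hex.choose_spec.eqOn hT h ⟨hT, le_rfl⟩

/-- The Frobenius norm is submultiplicative; its normed-ring structure is introduced only locally.
-/
lemma matrix_primitive_mul_primitive {F G f g : ℝ → Matrix (Fin n) (Fin n) ℂ}
    {a b : Matrix (Fin n) (Fin n) ℂ}
    (hf : IntegrableOn f (Set.Icc 0 T)) (hg : IntegrableOn g (Set.Icc 0 T))
    (hF : ∀ t ∈ Set.Icc 0 T, F t = a + ∫ s in (0 : ℝ)..t, f s)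
    (hG : ∀ t ∈ Set.Icc 0 T, G t = b + ∫ s in (0 : ℝ)..t, g s) :
    IntegrableOn (fun s => f s * G s + F s * g s) (Set.Icc 0 T) ∧
    ∀ t ∈ Set.Icc 0 T, F t * G t = a * b + ∫ s in (0 : ℝ)..t, (f s * G s + F s * g s) :=
  letI := Matrix.frobeniusNormedRing (m := Fin n) (α := ℂ)
  letI := Matrix.frobeniusNormedAlgebra (m := Fin n) (α := ℂ) (R := ℝ)
  primitive_mul_primitive hf hg hF hG

lemma matrix_continuousOn_mul {F G : ℝ → Matrix (Fin n) (Fin n) ℂ} {S : Set ℝ}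
    (hF : ContinuousOn F S) (hG : ContinuousOn G S) : ContinuousOn (fun s => F s * G s) S :=
  letI := Matrix.frobeniusNormedRing (m := Fin n) (α := ℂ)
  hF.mul hG

lemma matrix_continuousOn_conjTranspose {F : ℝ → Matrix (Fin n) (Fin n) ℂ} {S : Set ℝ}
    (hF : ContinuousOn F S) : ContinuousOn (fun s => (F s)ᴴ) S :=
  (conjTransposeCLM n).continuous.comp_continuousOn hF

lemma Control.map_integral {V W : Type*} [NormedAddCommGroup V] [NormedSpace ℝ V] [CompleteSpace V]
    [NormedAddCommGroup W] [NormedSpace ℝ W] [CompleteSpace W] (v : Control T) {X : ℝ → V}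
    (hX : ContinuousOn X (Set.Icc 0 T)) (L : V →L[ℝ] W) {t : ℝ} (ht : t ∈ Set.Icc 0 T) :
    L (∫ s in (0 : ℝ)..t, v s • X s) = ∫ s in (0 : ℝ)..t, v s • L (X s) := by
  rw [← L.intervalIntegral_comp_comm
    (intervalIntegrable_of_integrableOn_Icc (v.integrableOn_smul hX) ht)]
  simp only [map_smul]

section Conjugation

variable {U : ℝ → Matrix (Fin n) (Fin n) ℂ}

lemma IsPropagator.integrableOn (hU : IsPropagator H₀ H₁ u U) :
    IntegrableOn (fun s => (H₀ + u s • H₁) * U s) (Set.Icc 0 T) := by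
  have h₀ : ContinuousOn (fun s => H₀ * U s) (Set.Icc 0 T) :=
    matrix_continuousOn_mul continuousOn_const hU.1
  have h₁ : ContinuousOn (fun s => H₁ * U s) (Set.Icc 0 T) :=
    matrix_continuousOn_mul continuousOn_const hU.1
  simp only [add_mul, smul_mul_assoc]
  exact (h₀.integrableOn_compact isCompact_Icc).add (u.integrableOn_smul h₁)

/-- Conjugation by the propagator turns a primitive into a solution of the inhomogeneous
Liouville-von Neumann equation. -/
theorem IsPropagator.isMildSolution_conj (hH₀ : H₀ ∈ su n) (hH₁ : H₁ ∈ su n)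
    (hU : IsPropagator H₀ H₁ u U) {W w : ℝ → Matrix (Fin n) (Fin n) ℂ}
    {w₀ : Matrix (Fin n) (Fin n) ℂ} (hw : IntegrableOn w (Set.Icc 0 T))
    (hW : ∀ t ∈ Set.Icc 0 T, W t = w₀ + ∫ s in (0 : ℝ)..t, w s) :
    IsMildSolution (adCLM H₀) (adCLM H₁) u
      (fun t => w₀ + ∫ s in (0 : ℝ)..t, U s * w s * (U s)ᴴ) (fun t => U t * W t * (U t)ᴴ) := by
  have hWc : ContinuousOn W (Set.Icc 0 T) :=
    (continuousOn_const.add (continuousOn_primitive_Icc hw)).congr hW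
  have hUs := matrix_continuousOn_conjTranspose hU.1
  have hH : ∀ s, (H₀ + u s • H₁)ᴴ = -(H₀ + u s • H₁) := fun s => by
    rw [conjTranspose_add, conjTranspose_smul, (mem_su_iff.1 hH₀).1, (mem_su_iff.1 hH₁).1,
      star_trivial, smul_neg, neg_add]
  have hsi := hU.integrableOn
  have hstar : ∀ t ∈ Set.Icc 0 T,
      (U t)ᴴ = 1 + ∫ s in (0 : ℝ)..t, ((H₀ + u s • H₁) * U s)ᴴ := fun t ht => by
    conv_lhs => rw [hU.2 t ht]
    rw [conjTranspose_add, conjTranspose_one, ← conjTransposeCLM_apply,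
      ← (conjTransposeCLM n).intervalIntegral_comp_comm
        (intervalIntegrable_of_integrableOn_Icc hsi ht)]
    rfl
  obtain ⟨i1, h1⟩ := matrix_primitive_mul_primitive hsi hw hU.2 hW
  obtain ⟨i2, h2⟩ := matrix_primitive_mul_primitive i1
    ((conjTransposeCLM n).integrable_comp hsi) h1 hstar
  have hX : ContinuousOn (fun s => U s * W s * (U s)ᴴ) (Set.Icc 0 T) :=
    matrix_continuousOn_mul (matrix_continuousOn_mul hU.1 hWc) hUs
  have i3 : IntegrableOn (fun s => adCLM H₀ (U s * W s * (U s)ᴴ) +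
      u s • adCLM H₁ (U s * W s * (U s)ᴴ)) (Set.Icc 0 T) :=
    (((adCLM H₀).continuous.comp_continuousOn hX).integrableOn_compact isCompact_Icc).add
      (u.integrableOn_smul ((adCLM H₁).continuous.comp_continuousOn hX))
  -- Skew-Hermiticity of H₀ + uH₁ makes the terms where U and U† are differentiated combine into a
  -- commutator.
  have key : ∀ s, ((H₀ + u s • H₁) * U s * W s + U s * w s) * (U s)ᴴ +
      U s * W s * ((H₀ + u s • H₁) * U s)ᴴ = U s * w s * (U s)ᴴ +
        (adCLM H₀ (U s * W s * (U s)ᴴ) + u s • adCLM H₁ (U s * W s * (U s)ᴴ)) := fun s => by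
    rw [conjTranspose_mul, hH]
    simp only [adCLM_apply, Ring.lie_def, smul_sub]
    simp only [add_mul, mul_add, mul_neg, neg_add, smul_mul_assoc, mul_smul_comm, mul_assoc]
    abel
  refine ⟨hX, fun t ht => ?_⟩
  simp only [conjTransposeCLM_apply, key] at i2 h2
  have i4 : IntegrableOn (fun s => U s * w s * (U s)ᴴ) (Set.Icc 0 T) :=
    (i2.sub i3).congr_fun (fun s _ => add_sub_cancel_right _ _) measurableSet_Icc
  simp only [h2 t ht, one_mul, mul_one]
  rw [intervalIntegral.integral_add (intervalIntegrable_of_integrableOn_Icc i4 ht)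
    (intervalIntegrable_of_integrableOn_Icc i3 ht), add_assoc]

theorem IsPropagator.isTrajectory_conj (hH₀ : H₀ ∈ su n) (hH₁ : H₁ ∈ su n)
    (hU : IsPropagator H₀ H₁ u U) (ρ₀ : Matrix (Fin n) (Fin n) ℂ) :
    IsTrajectory H₀ H₁ ρ₀ u (fun t => U t * ρ₀ * (U t)ᴴ) := by
  have h := hU.isMildSolution_conj hH₀ hH₁ (w := fun _ => 0) (W := fun _ => ρ₀) (w₀ := ρ₀)
    integrableOn_zero (by simp)
  simpa [isTrajectory_iff] using h

/-- UU† and the constant 1 are both trajectories issued from 1, so uniqueness identifies them. -/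
theorem IsPropagator.mul_conjTranspose (hT : 0 ≤ T) (hH₀ : H₀ ∈ su n) (hH₁ : H₁ ∈ su n)
    (hU : IsPropagator H₀ H₁ u U) {t : ℝ} (ht : t ∈ Set.Icc 0 T) : U t * (U t)ᴴ = 1 := by
  have h1 : IsTrajectory H₀ H₁ 1 u (fun _ => 1) :=
    ⟨continuousOn_const, fun t _ => by simp [Ring.lie_def]⟩
  simpa using (hU.isTrajectory_conj hH₀ hH₁ 1).eqOn hT h1 ht

theorem IsPropagator.endPoint_eq (hT : 0 ≤ T) (hH₀ : H₀ ∈ su n) (hH₁ : H₁ ∈ su n)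
    (hU : IsPropagator H₀ H₁ u U) (ρ₀ : Matrix (Fin n) (Fin n) ℂ) :
    endPoint H₀ H₁ ρ₀ u = U T * ρ₀ * (U T)ᴴ :=
  QuantumControl.endPoint_eq hT (hU.isTrajectory_conj hH₀ hH₁ ρ₀)

lemma IsPropagator.continuousOn_conj (hU : IsPropagator H₀ H₁ u U) :
    ContinuousOn (fun s => (U s)ᴴ * H₁ * U s) (Set.Icc 0 T) :=
  matrix_continuousOn_mul (matrix_continuousOn_mul (matrix_continuousOn_conjTranspose hU.1)
    continuousOn_const) hU.1

/-- The end-point map is differentiable, with differential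
`v ↦ U(T) [∫₀ᵀ v(s) U(s)† H₁ U(s) ds, ρ₀] U(T)†`. -/
theorem IsPropagator.hasFDerivAt_endPoint (hT : 0 ≤ T) (hH₀ : H₀ ∈ su n) (hH₁ : H₁ ∈ su n)
    (hU : IsPropagator H₀ H₁ u U) (ρ₀ : Matrix (Fin n) (Fin n) ℂ) :
    ∃ D : Control T →L[ℝ] Matrix (Fin n) (Fin n) ℂ, HasFDerivAt (endPoint H₀ H₁ ρ₀) D u ∧
      ∀ v : Control T, D v =
        U T * ⁅∫ s in (0 : ℝ)..T, v s • ((U s)ᴴ * H₁ * U s), ρ₀⁆ * (U T)ᴴ := by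
  obtain ⟨D, hD, hDz⟩ := exists_hasFDerivAt_endpoint hT (adCLM H₀) (adCLM H₁) ρ₀
    (endPoint H₀ H₁ ρ₀) (fun w => by
      obtain ⟨ρ, hρ⟩ := exists_isTrajectory hT H₀ H₁ ρ₀ w
      exact ⟨ρ, isTrajectory_iff.1 hρ, QuantumControl.endPoint_eq hT hρ⟩) u
  refine ⟨D, hD, fun v => ?_⟩
  have hc := hU.continuousOn_conj
  have hbr : ∀ X : Matrix (Fin n) (Fin n) ℂ, ⁅X, ρ₀⁆ = -adCLM ρ₀ X := fun X => by
    rw [adCLM_apply, Ring.lie_def, Ring.lie_def, neg_sub]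
  have hcb : ContinuousOn (fun s => ⁅(U s)ᴴ * H₁ * U s, ρ₀⁆) (Set.Icc 0 T) := by
    simp only [hbr]
    exact ((adCLM ρ₀).continuous.comp_continuousOn hc).neg
  have hz := hU.isMildSolution_conj hH₀ hH₁ (w := fun s => v s • ⁅(U s)ᴴ * H₁ * U s, ρ₀⁆)
    (W := fun t => ∫ s in (0 : ℝ)..t, v s • ⁅(U s)ᴴ * H₁ * U s, ρ₀⁆) (w₀ := 0)
    (v.integrableOn_smul hcb) (by simp)
  -- By unitarity, conjugating [U†H₁U, ρ₀] by U gives [H₁, Uρ₀U†], the forcing term of the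
  -- linearized equation.
  have hz' : IsMildSolution (adCLM H₀) (adCLM H₁) u
      (fun t => ∫ s in (0 : ℝ)..t, v s • adCLM H₁ (U s * ρ₀ * (U s)ᴴ))
      (fun t => U t * (∫ s in (0 : ℝ)..t, v s • ⁅(U s)ᴴ * H₁ * U s, ρ₀⁆) * (U t)ᴴ) := by
    refine ⟨hz.1, fun t ht => (hz.2 t ht).trans ?_⟩
    congr 1
    simp only [zero_add]
    refine intervalIntegral.integral_congr fun s hs => ?_
    rw [Set.uIcc_of_le ht.1] at hs
    have hs1 := hU.mul_conjTranspose hT hH₀ hH₁ ⟨hs.1, hs.2.trans ht.2⟩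
    simp only [adCLM_apply, Ring.lie_def, mul_smul_comm, smul_mul_assoc]
    congr 1
    have e1 : U s * ((U s)ᴴ * H₁ * U s * ρ₀ - ρ₀ * ((U s)ᴴ * H₁ * U s)) * (U s)ᴴ =
        (U s * (U s)ᴴ) * (H₁ * (U s * ρ₀ * (U s)ᴴ)) -
          U s * ρ₀ * (U s)ᴴ * H₁ * (U s * (U s)ᴴ) := by noncomm_ring
    rw [e1, hs1, one_mul, mul_one]
  rw [hDz _ (isTrajectory_iff.1 (hU.isTrajectory_conj hH₀ hH₁ ρ₀)) v _ hz']
  have hm : ⁅∫ s in (0 : ℝ)..T, v s • ((U s)ᴴ * H₁ * U s), ρ₀⁆ =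
      ∫ s in (0 : ℝ)..T, v s • ⁅(U s)ᴴ * H₁ * U s, ρ₀⁆ := by
    simp only [hbr, smul_neg]
    rw [v.map_integral hc (adCLM ρ₀) ⟨hT, le_rfl⟩, intervalIntegral.integral_neg]
  rw [hm]

end Conjugation

end Evolution

/-! ### The orbit metric and the gradient of the cost -/

section OrbitGeometry

variable {n : ℕ} {ρ θ : Matrix (Fin n) (Fin n) ℂ}

lemma trace_mul_im_eq_zero {A B : Matrix (Fin n) (Fin n) ℂ} (hA : Aᴴ = -A) (hB : Bᴴ = -B) :
    (A * B).trace.im = 0 := by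
  rw [← Complex.conj_eq_iff_im, starRingEnd_apply, ← trace_conjTranspose, conjTranspose_mul, hA, hB,
    neg_mul_neg, trace_mul_comm]

/-- The trace is already real on su(n), so the complex orthogonality in `MemP` agrees with that of
the real form `suForm`. -/
lemma trace_conjTranspose_mul_eq_zero_iff {A B : Matrix (Fin n) (Fin n) ℂ} (hA : A ∈ su n)
    (hB : B ∈ su n) : (Aᴴ * B).trace = 0 ↔ (Aᴴ * B).trace.re = 0 := by
  refine ⟨fun h => by rw [h, Complex.zero_re], fun h => Complex.ext h ?_⟩
  refine trace_mul_im_eq_zero ?_ (mem_su_iff.1 hB).1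
  rw [(mem_su_iff.1 hA).1, conjTranspose_neg, (mem_su_iff.1 hA).1]

lemma trace_conjTranspose_mul_self_eq_zero {A : Matrix (Fin n) (Fin n) ℂ} :
    (Aᴴ * A).trace = 0 ↔ A = 0 := by
  open scoped ComplexOrder in exact trace_conjTranspose_mul_self_eq_zero_iff

/-- The scalar product `tr(Ω₁† Ω₂)` on `su(n)`. -/
noncomputable def suForm (n : ℕ) : LinearMap.BilinForm ℝ (su n) :=
  LinearMap.mk₂ ℝ (fun A B => ((A : Matrix (Fin n) (Fin n) ℂ)ᴴ * B).trace.re)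
    (by intros; simp [add_mul]) (by intros; simp)
    (by intros; simp [mul_add]) (by intros; simp)

lemma suForm_apply (A B : su n) :
    suForm n A B = ((A : Matrix (Fin n) (Fin n) ℂ)ᴴ * B).trace.re := rfl

lemma suForm_self_eq_zero {A : su n} (h : suForm n A A = 0) : A = 0 := by
  rw [suForm_apply, ← trace_conjTranspose_mul_eq_zero_iff A.2 A.2,
    trace_conjTranspose_mul_self_eq_zero] at h
  exact Subtype.ext h

lemma suForm_isSymm (n : ℕ) : (suForm n).IsSymm := ⟨fun A B => by
  rw [suForm_apply, suForm_apply, (mem_su_iff.1 A.2).1, (mem_su_iff.1 B.2).1,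
    neg_mul, neg_mul, trace_neg, trace_neg, trace_mul_comm]⟩

/-- The map `Ω ↦ [ρ, Ω]` on `su(n)`. -/
noncomputable def suBracket (ρ : Matrix (Fin n) (Fin n) ℂ) :
    su n →ₗ[ℝ] Matrix (Fin n) (Fin n) ℂ :=
  (LinearMap.mulLeft ℝ ρ - LinearMap.mulRight ℝ ρ).domRestrict (su n)

lemma mem_tangentSpace_iff {ξ : Matrix (Fin n) (Fin n) ℂ} :
    ξ ∈ tangentSpace ρ ↔ ∃ Ω ∈ su n, ⁅ρ, Ω⁆ = ξ := Iff.rfl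

lemma memP_iff {Ω : su n} :
    MemP ρ Ω ↔ Ω ∈ (suForm n).orthogonal (LinearMap.ker (suBracket ρ)) := by
  rw [LinearMap.BilinForm.mem_orthogonal_iff, MemP, and_iff_right Ω.2, Subtype.forall]
  refine forall₂_congr fun Λ hΛ => imp_congr Iff.rfl ?_
  rw [trace_conjTranspose_mul_eq_zero_iff Ω.2 hΛ, (suForm_isSymm n).eq]
  rfl

/-- Definiteness splits su(n) into the stabilizer algebra and 𝔭_ρ; dropping the stabilizer component
leaves the bracket unchanged. -/
lemma exists_memP_bracket_eq {ξ : Matrix (Fin n) (Fin n) ℂ} (hξ : ξ ∈ tangentSpace ρ) :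
    ∃ Ω, MemP ρ Ω ∧ ⁅ρ, Ω⁆ = ξ := by
  obtain ⟨Ω, hΩ, rfl⟩ := mem_tangentSpace_iff.1 hξ
  have hcompl : IsCompl (LinearMap.ker (suBracket ρ))
      ((suForm n).orthogonal (LinearMap.ker (suBracket ρ))) := by
    refine LinearMap.BilinForm.isCompl_orthogonal_of_restrict_nondegenerate
      (suForm_isSymm n).isRefl ?_
    exact ⟨fun A hA => Subtype.ext (suForm_self_eq_zero (hA A)),
      fun A hA => Subtype.ext (suForm_self_eq_zero (hA A))⟩
  obtain ⟨a, ha, b, hb, hab⟩ := Submodule.mem_sup.1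
    (hcompl.sup_eq_top ▸ Submodule.mem_top (x := (⟨Ω, hΩ⟩ : su n)))
  refine ⟨b, memP_iff.2 hb, ?_⟩
  have h := congr(suBracket ρ $hab)
  rwa [map_add, LinearMap.mem_ker.1 ha, zero_add] at h

lemma MemP.add {A B : Matrix (Fin n) (Fin n) ℂ} (hA : MemP ρ A) (hB : MemP ρ B) :
    MemP ρ (A + B) :=
  ⟨add_mem hA.1 hB.1, fun Λ h h' => by
    rw [conjTranspose_add, add_mul, trace_add, hA.2 Λ h h', hB.2 Λ h h', add_zero]⟩

lemma MemP.smul {A : Matrix (Fin n) (Fin n) ℂ} (c : ℝ) (hA : MemP ρ A) : MemP ρ (c • A) :=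
  ⟨(su n).smul_mem c hA.1, fun Λ h h' => by
    rw [conjTranspose_smul, smul_mul_assoc, trace_smul, hA.2 Λ h h', smul_zero]⟩

lemma MemP.eq_of_bracket_eq {A B : Matrix (Fin n) (Fin n) ℂ} (hA : MemP ρ A) (hB : MemP ρ B)
    (h : ⁅ρ, A⁆ = ⁅ρ, B⁆) : A = B := by
  have hd : MemP ρ (A + (-1 : ℝ) • B) := hA.add (hB.smul _)
  have h0 := hd.2 _ hd.1 (by
    rw [neg_one_smul, ← sub_eq_add_neg]
    simp only [Ring.lie_def, mul_sub, sub_mul] at h ⊢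
    rw [sub_sub_sub_comm, h, sub_self])
  rw [trace_conjTranspose_mul_self_eq_zero, neg_one_smul, ← sub_eq_add_neg, sub_eq_zero] at h0
  exact h0

lemma lift_spec {ξ : Matrix (Fin n) (Fin n) ℂ} (hξ : ξ ∈ tangentSpace ρ) :
    MemP ρ (lift ρ ξ) ∧ ⁅ρ, lift ρ ξ⁆ = ξ := by
  have h := exists_memP_bracket_eq hξ
  rw [lift, dif_pos h]
  exact h.choose_spec

lemma lift_bracket {Ω : Matrix (Fin n) (Fin n) ℂ} (hΩ : MemP ρ Ω) : lift ρ ⁅ρ, Ω⁆ = Ω := by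
  have h := lift_spec (ρ := ρ) (mem_tangentSpace_iff.2 ⟨Ω, hΩ.1, rfl⟩)
  exact h.1.eq_of_bracket_eq hΩ h.2

/-- `lift ρ`, as a linear map on the tangent space. -/
noncomputable def liftLinear (ρ : Matrix (Fin n) (Fin n) ℂ) :
    tangentSpace ρ →ₗ[ℝ] Matrix (Fin n) (Fin n) ℂ where
  toFun ξ := lift ρ ξ
  map_add' ξ η := by
    obtain ⟨h1, e1⟩ := lift_spec ξ.2
    obtain ⟨h2, e2⟩ := lift_spec η.2
    have e : (ξ + η : Matrix (Fin n) (Fin n) ℂ) = ⁅ρ, lift ρ ξ + lift ρ η⁆ := by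
      conv_lhs => rw [← e1, ← e2]
      simp only [Ring.lie_def, mul_add, add_mul]
      abel
    rw [Submodule.coe_add, e, lift_bracket (h1.add h2)]
  map_smul' c ξ := by
    obtain ⟨h1, e1⟩ := lift_spec ξ.2
    have e : (c • ξ : Matrix (Fin n) (Fin n) ℂ) = ⁅ρ, c • lift ρ ξ⁆ := by
      conv_lhs => rw [← e1]
      simp only [Ring.lie_def, mul_smul_comm, smul_mul_assoc, smul_sub]
    rw [Submodule.coe_smul, e, lift_bracket (h1.smul c), RingHom.id_apply]

/-- The metric of the orbit at `ρ`, as a bilinear form on the tangent space. -/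
noncomputable def metricForm (ρ : Matrix (Fin n) (Fin n) ℂ) :
    LinearMap.BilinForm ℝ (tangentSpace ρ) :=
  LinearMap.mk₂ ℝ (fun ξ η => ((liftLinear ρ ξ)ᴴ * liftLinear ρ η).trace.re)
    (by intros; simp [add_mul]) (by intros; simp)
    (by intros; simp [mul_add]) (by intros; simp)

lemma metricForm_apply (ξ η : tangentSpace ρ) : metricForm ρ ξ η = metric ρ ξ η := rfl

lemma metricForm_self_eq_zero {ξ : tangentSpace ρ} (h : metricForm ρ ξ ξ = 0) : ξ = 0 := by
  obtain ⟨h1, e1⟩ := lift_spec ξ.2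
  rw [metricForm_apply, metric, ← trace_conjTranspose_mul_eq_zero_iff h1.1 h1.1,
    trace_conjTranspose_mul_self_eq_zero] at h
  rw [h] at e1
  exact Subtype.ext (by simpa [Ring.lie_def] using e1.symm)

lemma bracket_mem_su (hρ : ρ.IsHermitian) (hθ : θ.IsHermitian) : ⁅ρ, θ⁆ ∈ su n := by
  refine mem_su_iff.2 ⟨?_, ?_⟩
  · rw [Ring.lie_def, conjTranspose_sub, conjTranspose_mul, conjTranspose_mul, hρ.eq, hθ.eq, neg_sub]
  · rw [Ring.lie_def, trace_sub, trace_mul_comm, sub_self]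

lemma trace_bracket_mul (A B C : Matrix (Fin n) (Fin n) ℂ) :
    (⁅A, B⁆ * C).trace = (B * ⁅C, A⁆).trace := by
  simp only [Ring.lie_def, sub_mul, mul_sub, trace_sub]
  rw [mul_assoc A B C, trace_mul_comm A, mul_assoc, mul_assoc]

/-- By cyclicity tr([ρ, θ]Λ) = tr(θ[Λ, ρ]), which vanishes on the stabilizer. Thus [ρ, θ] is its own
lift and no projection has to be computed. -/
lemma bracket_memP (hρ : ρ.IsHermitian) (hθ : θ.IsHermitian) : MemP ρ ⁅ρ, θ⁆ := by
  have h := bracket_mem_su hρ hθ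
  refine ⟨h, fun Λ _ hΛ' => ?_⟩
  rw [(mem_su_iff.1 h).1, neg_mul, trace_neg, trace_bracket_mul]
  have : ⁅Λ, ρ⁆ = 0 := by
    rw [Ring.lie_def] at hΛ' ⊢
    rw [← neg_sub, hΛ', neg_zero]
  rw [this, mul_zero, trace_zero, neg_zero]

section Gradient

attribute [local instance] frobeniusTopology

/-- The cost, as a continuous linear functional. -/
noncomputable def costCLM (θ : Matrix (Fin n) (Fin n) ℂ) : Matrix (Fin n) (Fin n) ℂ →L[ℝ] ℝ :=
  Complex.reCLM.comp (LinearMap.toContinuousLinearMap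
    ((Matrix.traceLinearMap (Fin n) ℝ ℂ).comp (LinearMap.mulRight ℝ θ)))

lemma costCLM_apply (X : Matrix (Fin n) (Fin n) ℂ) : costCLM θ X = cost θ X := rfl

lemma hasFDerivAt_cost : HasFDerivAt (cost θ) (costCLM θ) ρ := (costCLM θ).hasFDerivAt

end Gradient

lemma fderiv_cost_apply (η : Matrix (Fin n) (Fin n) ℂ) : fderiv ℝ (cost θ) ρ η = cost θ η :=
  congr($(HasFDerivAt.fderiv hasFDerivAt_cost) η)

/-- The gradient of the cost restricted to the orbit is `[ρ, [ρ, θ]]`. -/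
theorem isOrbitGradient_bracket (hρ : ρ.IsHermitian) (hθ : θ.IsHermitian) :
    IsOrbitGradient θ ρ ⟨⁅ρ, ⁅ρ, θ⁆⁆, mem_tangentSpace_iff.2 ⟨_, bracket_mem_su hρ hθ, rfl⟩⟩ := by
  intro η hη
  have hm := bracket_memP hρ hθ
  obtain ⟨h1, e1⟩ := lift_spec hη
  rw [fderiv_cost_apply, metric, lift_bracket hm, (mem_su_iff.1 hm.1).1, cost]
  conv_lhs => rw [← e1]
  rw [trace_bracket_mul, trace_mul_comm]
  congr 3
  rw [Ring.lie_def, Ring.lie_def, neg_sub]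

theorem IsOrbitGradient.unique {G G' : tangentSpace ρ} (h : IsOrbitGradient θ ρ G)
    (h' : IsOrbitGradient θ ρ G') : G = G' := by
  refine sub_eq_zero.1 (metricForm_self_eq_zero ?_)
  have := (h _ (G - G').2).symm.trans (h' _ (G - G').2)
  rw [LinearMap.map_sub₂, metricForm_apply, metricForm_apply, this, sub_self]

end OrbitGeometry

variable {n : ℕ} {T : ℝ} {H₀ H₁ ρ₀ θ : Matrix (Fin n) (Fin n) ℂ} {u : Control T}

/-- Conjugation ignores phases: rescaling U by an n-th root of the conjugate of its determinant
lands in SU(n). This avoids proving det U(T) = 1. -/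
lemma conj_mem_orbit {U : Matrix (Fin n) (Fin n) ℂ} (hU : U * Uᴴ = 1)
    (ρ₀ : Matrix (Fin n) (Fin n) ℂ) : U * ρ₀ * Uᴴ ∈ orbit ρ₀ := by
  have hdet : star U.det * U.det = 1 := by
    rw [mul_comm, ← det_conjTranspose, ← det_mul, hU, det_one]
  obtain ⟨c, hc, hcd⟩ : ∃ c : ℂ, c * star c = 1 ∧ c ^ n * U.det = 1 := by
    rcases Nat.eq_zero_or_pos n with rfl | hn
    · exact ⟨1, by simp, by simp⟩
    · obtain ⟨c, hc⟩ := IsAlgClosed.exists_pow_nat_eq (star U.det) hn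
      refine ⟨c, ?_, by rw [hc, hdet]⟩
      have hd : ‖U.det‖ = 1 := by
        have := congr(‖$hdet‖)
        rw [norm_mul, norm_star, norm_one] at this
        nlinarith [norm_nonneg U.det]
      have hn1 : ‖c‖ ^ n = 1 := by rw [← norm_pow, hc, norm_star, hd]
      have hc1 : ‖c‖ = 1 := (pow_eq_one_iff_of_nonneg (norm_nonneg c) hn.ne').1 hn1
      rw [← starRingEnd_apply, Complex.mul_conj, Complex.normSq_eq_norm_sq, hc1]
      simp
  refine ⟨c • U, mem_specialUnitaryGroup_iff.2 ⟨?_, ?_⟩, ?_⟩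
  · rw [mem_unitaryGroup_iff, star_eq_conjTranspose, conjTranspose_smul, smul_mul_smul_comm, hc, hU,
      one_smul]
  · rw [det_smul, Fintype.card_fin, hcd]
  · rw [conjTranspose_smul, smul_mul_assoc, smul_mul_smul_comm, hc, one_smul]

/-! ### The gradient density in control space -/

section Calculus

attribute [local instance] frobeniusTopology

variable {U : ℝ → Matrix (Fin n) (Fin n) ℂ}

lemma IsPropagator.integral_conj_mem_su (hT : 0 ≤ T) (hH₀ : H₀ ∈ su n) (hH₁ : H₁ ∈ su n)
    (hU : IsPropagator H₀ H₁ u U) (v : Control T) :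
    ∫ s in (0 : ℝ)..T, v s • ((U s)ᴴ * H₁ * U s) ∈ su n := by
  have hTm : T ∈ Set.Icc 0 T := ⟨hT, le_rfl⟩
  refine mem_su_iff.2 ⟨?_, ?_⟩
  · rw [← conjTransposeCLM_apply, v.map_integral hU.continuousOn_conj _ hTm,
      ← intervalIntegral.integral_neg]
    congr 1 with s : 1
    rw [conjTransposeCLM_apply, conjTranspose_mul, conjTranspose_mul, conjTranspose_conjTranspose,
      (mem_su_iff.1 hH₁).1, ← smul_neg]
    noncomm_ring
  · have h := v.map_integral hU.continuousOn_conj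
      (LinearMap.toContinuousLinearMap (Matrix.traceLinearMap (Fin n) ℝ ℂ)) hTm
    refine (h.trans ?_ :)
    rw [intervalIntegral.integral_congr (g := fun _ => (0 : ℂ)), intervalIntegral.integral_zero]
    intro s hs
    rw [Set.uIcc_of_le hT] at hs
    simp only [LinearMap.coe_toContinuousLinearMap', traceLinearMap_apply]
    rw [mul_assoc, trace_mul_comm, mul_assoc, hU.mul_conjTranspose hT hH₀ hH₁ hs, mul_one,
      (mem_su_iff.1 hH₁).2, smul_zero]

lemma IsPropagator.conjTranspose_mul (hT : 0 ≤ T) (hH₀ : H₀ ∈ su n) (hH₁ : H₁ ∈ su n)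
    (hU : IsPropagator H₀ H₁ u U) {t : ℝ} (ht : t ∈ Set.Icc 0 T) : (U t)ᴴ * U t = 1 :=
  mul_eq_one_comm.1 (hU.mul_conjTranspose hT hH₀ hH₁ ht)

lemma conj_bracket_mem_tangentSpace {V Y : Matrix (Fin n) (Fin n) ℂ} (hV : Vᴴ * V = 1)
    (hY : Y ∈ su n) : V * ⁅Y, ρ₀⁆ * Vᴴ ∈ tangentSpace (V * ρ₀ * Vᴴ) := by
  obtain ⟨hY1, hY2⟩ := mem_su_iff.1 hY
  -- The sign appears because tangent vectors are written [ρ, Ω], while here ρ₀ is the second entry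
  -- of the bracket.
  refine mem_tangentSpace_iff.2 ⟨-(V * Y * Vᴴ), mem_su_iff.2 ⟨?_, ?_⟩, ?_⟩
  · rw [conjTranspose_neg, Matrix.conjTranspose_mul, Matrix.conjTranspose_mul,
      conjTranspose_conjTranspose, hY1]
    noncomm_ring
  · rw [trace_neg, trace_mul_comm, ← mul_assoc, hV, one_mul, hY2, neg_zero]
  · have e : ⁅V * ρ₀ * Vᴴ, -(V * Y * Vᴴ)⁆ =
        V * Y * (Vᴴ * V) * ρ₀ * Vᴴ - V * ρ₀ * (Vᴴ * V) * Y * Vᴴ := by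
      rw [Ring.lie_def]
      noncomm_ring
    rw [e, hV, Ring.lie_def]
    noncomm_ring

/-- The density of the gradient of the cost in control space. -/
noncomputable def gradientDensity (H₁ ρ₀ θ : Matrix (Fin n) (Fin n) ℂ)
    (U : ℝ → Matrix (Fin n) (Fin n) ℂ) (T t : ℝ) : ℝ :=
  cost ((U T)ᴴ * θ * U T) ⁅(U t)ᴴ * H₁ * U t, ρ₀⁆

lemma IsPropagator.continuousOn_gradientDensity (hU : IsPropagator H₀ H₁ u U) :
    ContinuousOn (gradientDensity H₁ ρ₀ θ U T) (Set.Icc 0 T) := by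
  have h := (costCLM ((U T)ᴴ * θ * U T)).continuous.comp_continuousOn
    ((adCLM ρ₀).continuous.comp_continuousOn hU.continuousOn_conj)
  refine h.neg.congr fun t _ => ?_
  change cost _ _ = -cost _ _
  rw [Function.comp_apply, adCLM_apply, cost, cost, ← Complex.neg_re, ← trace_neg, ← neg_mul]
  simp only [Ring.lie_def, neg_sub]

/-- Cyclicity moves the conjugation by U(T) onto θ; the remaining functional is continuous and
linear, so it passes under the integral. -/
lemma cost_conj_integral (hT : 0 ≤ T) (hU : IsPropagator H₀ H₁ u U) (v : Control T) :
    cost θ (U T * ⁅∫ s in (0 : ℝ)..T, v s • ((U s)ᴴ * H₁ * U s), ρ₀⁆ * (U T)ᴴ) =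
      ∫ s in (0 : ℝ)..T, v s * gradientDensity H₁ ρ₀ θ U T s := by
  have h := v.map_integral hU.continuousOn_conj
    ((costCLM ((U T)ᴴ * θ * U T)).comp (-adCLM ρ₀)) ⟨hT, le_rfl⟩
  have e : ∀ X, (costCLM ((U T)ᴴ * θ * U T)).comp (-adCLM ρ₀) X =
      cost ((U T)ᴴ * θ * U T) ⁅X, ρ₀⁆ := fun X => by
    rw [ContinuousLinearMap.comp_apply, costCLM_apply]
    congr 1
    change -⁅ρ₀, X⁆ = _
    simp only [Ring.lie_def, neg_sub]
  simp only [e] at h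
  refine Eq.trans ?_ h
  rw [cost, cost]
  congr 1
  rw [mul_assoc, mul_assoc, trace_mul_comm]
  simp only [mul_assoc]

lemma gradientDensity_eq (hH₁ : H₁ ∈ su n) (hρ₀ : ρ₀.IsHermitian) (hθ : θ.IsHermitian) (t : ℝ) :
    (gradientDensity H₁ ρ₀ θ U T t : ℂ) =
      -(⁅ρ₀, (U T)ᴴ * θ * U T⁆ᴴ * ((U t)ᴴ * H₁ * U t)).trace := by
  have hΘ : ((U T)ᴴ * θ * U T).IsHermitian := isHermitian_conjTranspose_mul_mul _ hθ
  have hb := (mem_su_iff.1 (bracket_mem_su hρ₀ hΘ)).1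
  have hY : ((U t)ᴴ * H₁ * U t)ᴴ = -((U t)ᴴ * H₁ * U t) := by
    rw [Matrix.conjTranspose_mul, Matrix.conjTranspose_mul, conjTranspose_conjTranspose,
      (mem_su_iff.1 hH₁).1]
    noncomm_ring
  have htr : (⁅(U t)ᴴ * H₁ * U t, ρ₀⁆ * ((U T)ᴴ * θ * U T)).trace =
      (⁅ρ₀, (U T)ᴴ * θ * U T⁆ * ((U t)ᴴ * H₁ * U t)).trace := by
    rw [trace_bracket_mul ρ₀, trace_mul_comm]
  rw [hb, neg_mul, trace_neg, neg_neg, gradientDensity, cost, htr]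
  exact Complex.ext rfl (trace_mul_im_eq_zero hb hY).symm

/-- An element of `L²` that represents the functional `v ↦ ∫₀ᵀ v g` for a continuous `g` is
almost everywhere equal to `g`. -/
lemma Control.ae_eq_of_inner_eq (hT : 0 ≤ T) {g : ℝ → ℝ} (hg : ContinuousOn g (Set.Icc 0 T))
    (a : Control T) (ha : ∀ v : Control T, inner ℝ a v = ∫ s in (0 : ℝ)..T, v s * g s) :
    a =ᵐ[volume.restrict (Set.Icc 0 T)] g := by
  have hmem : MemLp g 2 (volume.restrict (Set.Icc 0 T)) := by
    refine (memLp_two_iff_integrable_sq (hg.aestronglyMeasurable measurableSet_Icc)).2 ?_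
    exact (hg.pow 2).integrableOn_compact isCompact_Icc
  have : a = hmem.toLp g := by
    refine ext_inner_right ℝ fun v => ?_
    rw [ha, L2.inner_def, intervalIntegral.integral_of_le hT, ← integral_Icc_eq_integral_Ioc]
    refine integral_congr_ae ?_
    filter_upwards [hmem.coeFn_toLp] with s hs
    rw [hs]
    simp
  rw [this]
  exact hmem.coeFn_toLp

end Calculus

/-! ### Riesz representation and the chain rule -/

section Adjoint

attribute [local instance] frobeniusTopology

/-- A bounded linear map from a Hilbert space into a tangent space of the orbit has an adjoint. -/
lemma exists_metric_adjoint {E : Type*} [NormedAddCommGroup E] [InnerProductSpace ℝ E]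
    [CompleteSpace E] {ρ : Matrix (Fin n) (Fin n) ℂ} (D : E →L[ℝ] Matrix (Fin n) (Fin n) ℂ)
    (hD : ∀ v, D v ∈ tangentSpace ρ) :
    ∃ A : tangentSpace ρ →ₗ[ℝ] E, ∀ z v, inner ℝ (A z) v = metric ρ z (D v) := by
  let B : tangentSpace ρ →ₗ[ℝ] (E →L[ℝ] ℝ) :=
    { toFun := fun z =>
        (LinearMap.toContinuousLinearMap (metricForm ρ z)).comp (D.codRestrict _ hD)
      map_add' := fun z w => by ext v; simp
      map_smul' := fun c z => by ext v; simp }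
  exact ⟨(InnerProductSpace.toDual ℝ E).symm.toLinearEquiv.toLinearMap.comp B,
    fun z v => InnerProductSpace.toDual_symm_apply⟩

/-- The gradient in control space is the adjoint differential applied to the orbit gradient. -/
lemma hasGradientAt_cost_comp {E : Type*} [NormedAddCommGroup E] [InnerProductSpace ℝ E]
    [CompleteSpace E] {f : E → Matrix (Fin n) (Fin n) ℂ} {u a : E}
    {D : E →L[ℝ] Matrix (Fin n) (Fin n) ℂ} (hf : HasFDerivAt f D u)
    (ha : ∀ v, cost θ (D v) = inner ℝ a v) : HasGradientAt (fun w => cost θ (f w)) a u := by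
  rw [hasGradientAt_iff_hasFDerivAt]
  have h : HasFDerivAt (fun w => cost θ (f w)) ((costCLM θ).comp D) u :=
    hasFDerivAt_cost.comp u hf
  have e : (costCLM θ).comp D = InnerProductSpace.toDual ℝ E a := by
    ext v
    exact ha v
  rwa [e] at h

end Adjoint

end QuantumControl

theorem mainTheorem7 (n : ℕ) (T : ℝ) (hT : 0 < T)
    (H₀ H₁ ρ₀ θ : Matrix (Fin n) (Fin n) ℂ)
    (hH₀ : H₀ ∈ su n) (hH₁ : H₁ ∈ su n)
    (hρ₀ : ρ₀.IsHermitian) (hθ : θ.IsHermitian) :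
    -- the two evolution equations are well posed
    (∀ u : Control T, ∃ ρ, IsTrajectory H₀ H₁ ρ₀ u ρ ∧
      ∀ ρ', IsTrajectory H₀ H₁ ρ₀ u ρ' → Set.EqOn ρ' ρ (Set.Icc 0 T)) ∧
    (∀ u : Control T, ∃ U, IsPropagator H₀ H₁ u U ∧
      ∀ U', IsPropagator H₀ H₁ u U' → Set.EqOn U' U (Set.Icc 0 T)) ∧
    ∀ u : Control T,
      -- the end-point map takes values in the orbit, is differentiable,
      -- and its differential takes values in the tangent space of the orbit
      endPoint H₀ H₁ ρ₀ u ∈ orbit ρ₀ ∧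
      DifferentiableAt ℝ (endPoint (T := T) H₀ H₁ ρ₀) u ∧
      (∀ v : Control T, fderiv ℝ (endPoint H₀ H₁ ρ₀) u v ∈
        tangentSpace (endPoint H₀ H₁ ρ₀ u)) ∧
      -- `A` is the adjoint of the differential, `G` is the gradient of `J` at the end-point
      ∃ (A : tangentSpace (endPoint H₀ H₁ ρ₀ u) →ₗ[ℝ] Control T)
        (G : tangentSpace (endPoint H₀ H₁ ρ₀ u)),
        IsAdjointDiff H₀ H₁ ρ₀ u A ∧
        (∀ A', IsAdjointDiff H₀ H₁ ρ₀ u A' → A' = A) ∧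
        IsOrbitGradient θ (endPoint H₀ H₁ ρ₀ u) G ∧
        (∀ G', IsOrbitGradient θ (endPoint H₀ H₁ ρ₀ u) G' → G' = G) ∧
        HasGradientAt (fun w : Control T => cost θ (endPoint H₀ H₁ ρ₀ w)) (A G) u ∧
        ∀ U, IsPropagator H₀ H₁ u U →
          ∀ᵐ t ∂(volume.restrict (Set.Icc (0 : ℝ) T)),
            (((A G : Control T) t : ℝ) : ℂ) =
              -(⁅ρ₀, (U T)ᴴ * θ * U T⁆ᴴ * ((U t)ᴴ * H₁ * U t)).trace := by
  have hT' := hT.le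
  refine ⟨fun u => ?_, fun u => ?_, fun u => ?_⟩
  · obtain ⟨ρ, hρ⟩ := exists_isTrajectory hT' H₀ H₁ ρ₀ u
    exact ⟨ρ, hρ, fun ρ' hρ' => hρ'.eqOn hT' hρ⟩
  · obtain ⟨U, hU⟩ := exists_isPropagator hT' H₀ H₁ u
    exact ⟨U, hU, fun U' hU' => hU'.eqOn hT' hU⟩
  obtain ⟨U, hU⟩ := exists_isPropagator hT' H₀ H₁ u
  have hTm : T ∈ Set.Icc 0 T := ⟨hT', le_rfl⟩
  have hE := hU.endPoint_eq hT' hH₀ hH₁ ρ₀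
  obtain ⟨D, hD, hDv⟩ := hU.hasFDerivAt_endPoint hT' hH₀ hH₁ ρ₀
  have hDmem : ∀ v, D v ∈ tangentSpace (endPoint H₀ H₁ ρ₀ u) := fun v => by
    rw [hE, hDv]
    exact conj_bracket_mem_tangentSpace (hU.conjTranspose_mul hT' hH₀ hH₁ hTm)
      (hU.integral_conj_mem_su hT' hH₀ hH₁ v)
  have hfd : ∀ v, fderiv ℝ (endPoint H₀ H₁ ρ₀) u v = D v := fun v =>
    congr($(HasFDerivAt.fderiv hD) v)
  have hherm : (endPoint H₀ H₁ ρ₀ u).IsHermitian :=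
    hE ▸ isHermitian_mul_mul_conjTranspose _ hρ₀
  obtain ⟨A, hA⟩ := exists_metric_adjoint D hDmem
  have hG := isOrbitGradient_bracket hherm hθ
  -- J is linear, hence its own differential: J(Dv) = dJ(Dv) = ⟨G, Dv⟩ = (A G, v).
  have hcost : ∀ v, cost θ (D v) = inner ℝ (A _) v := fun v => by
    rw [hA, ← hG _ (hDmem v), fderiv_cost_apply]
  refine ⟨hE ▸ conj_mem_orbit (hU.mul_conjTranspose hT' hH₀ hH₁ hTm) ρ₀,
    HasFDerivAt.differentiableAt hD, fun v => hfd v ▸ hDmem v, A, _, fun z v => by rw [hfd, hA],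
    fun A' hA' => ?_, hG, fun G' hG' => hG'.unique hG, hasGradientAt_cost_comp hD hcost,
    fun U' hU' => ?_⟩
  · refine LinearMap.ext fun z => ext_inner_right ℝ fun v => ?_
    rw [← hA', hfd, hA]
  -- The formula is needed for an arbitrary propagator; uniqueness of the derivative transfers it to
  -- D.
  · have hDv' : ∀ v, D v = U' T * ⁅∫ s in (0 : ℝ)..T, v s • ((U' s)ᴴ * H₁ * U' s), ρ₀⁆ *
        (U' T)ᴴ := by
      obtain ⟨D', hD', hDv'⟩ := hU'.hasFDerivAt_endPoint hT' hH₀ hH₁ ρ₀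
      rwa [HasFDerivAt.unique hD hD']
    have hae := Control.ae_eq_of_inner_eq hT' (hU'.continuousOn_gradientDensity (ρ₀ := ρ₀) (θ := θ))
      _ fun v => by rw [← hcost, hDv', cost_conj_integral hT' hU']
    filter_upwards [hae] with t ht
    rw [ht, gradientDensity_eq hH₁ hρ₀ hθ]
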